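/- **Setting.** A finite-horizon tabular cost-accumulating MDP (caMDP) $M$ consists of a horizon $H\ge 1$, a finite state set $\mathcal S=\{1,\dots,S\}$, a finite action set $\mathcal A$ with $A=|\mathcal A|$, nonempty sets $\mathcal A_h(s)\subseteq\mathcal A$ of available actions, transition distributions $P_h(\cdot\mid s,a)$ on $\mathcal S$, expected rewards $r_h(s,a)\in\mathbb R$, cost vectors $c_h(s,a)\in\mathbb R^m$ ($h\in[H]$), and an initial state $s_0$. $\Pi^D$ is the set of deterministic history-dependent policies, and $V^\pi_M=\mathbb E^\pi_M[\sum_{h=1}^H r_h(s_h,a_h)]$. A cost criterion assigns to every $M$ and $\pi\in\Pi^D$ a vector $C^\pi_M\in\mathbb R^m$. It is *shortly recursive* (SR) with functions $(f,g)$ if $C^\pi_M=C^\pi_1(s_0)$, where $C^\pi_{H+1}=0$ and, for $h\in[H]$ and every history $\tau_h$ with current state $s$ and $a=\pi_h(\tau_h)$, $$C^\pi_h(\tau_h)=c_h(s,a)+f_{s'}\,g(P_h(s'\mid s,a))\,C^\pi_{h+1}(\tau_h,a,s').$$ Here $f_{s'}$ is the finite extension (over $s'=1,\dots,S$) of an associative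 non-decreasing binary function $f$ on $\mathbb R^m$ with $f(0,x)=f(x,0)=x$ that is a short map ($1$-Lipschitz for $\|\cdot\|_\infty$) in each argument; $g$ is $[0,1]$-valued in each coordinate, with $g(0)=0$, and acts componentwise; and $x\mapsto f_{s'}\,g(p_{s'})x_{s'}$ is a short map for every probability vector $p$. For a budget $B\in\mathbb R^m$ put $V^*=\sup\{V^\pi_M:\pi\in\Pi^D,\ C^\pi_M\le B\}$ ($-\infty$ if no such $\pi$ exists; the instance is then called infeasible). Let $c_{\max},c_{\min}\in\mathbb R^m$ be the componentwise largest and smallest values among $0$ and the costs $c_h(s,a)$, $a\in\mathcal A_h(s)$. **Algorithm Bicriteria** with rounding unit $\ell>0$. Write $\lceil x\rceil_\ell=\lceil x/\ell\rceil\,\ell$ and $\kappa(b)=b+\ell(S+1)$, componentwise. Let $\hat{\mathcal B}=\{\lceil b\rceil_\ell: b\in[b_{\min},b_{\max}]^m\}$, where $b_{\min}$ and $b_{\max}$ are $H$ times the smallest and the largest number among $0$ and all coordinates of all costs of available actions. Put $\hat V_{H+1}(s,b)=0$ if $b\ge 0$ and $-\infty$ otherwise. For $h=H,\dots,1$, $s\in\mathcal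 S$ and $b\in\hat{\mathcal B}$ (for $h=1$ also $b=\lceil B\rceil_\ell$) compute $$\hat V_h(s,b)=\max_{a\in\mathcal A_h(s)} r_h(s,a)+\hat V^{s,a}_{h,b}(1,0),$$ where $\hat V^{s,a}_{h,b}(S+1,F)$ is $0$ if $c_h(s,a)+F\le\kappa(b)$ and $-\infty$ otherwise, and for $t\in[S]$ $$\hat V^{s,a}_{h,b}(t,F)=\max_{b_t\in\hat{\mathcal B}} P_h(t\mid s,a)\hat V_{h+1}(t,b_t)+\hat V^{s,a}_{h,b}\bigl(t+1,\lceil f(F,g(P_h(t\mid s,a))b_t)\rceil_\ell\bigr)$$ (with $0\cdot(-\infty)=0$) is tabulated over the partial costs $F$ that are reachable from $0$. If $\hat V_1(s_0,\lceil B\rceil_\ell)=-\infty$, report "Infeasible". Otherwise output the maximizing choices $(s,b)\mapsto(a,(b_{s'})_{s'})$ at each step; these are executed in $M$ as a deterministic policy by starting with budget $\lceil B\rceil_\ell$ and replacing the current budget by $b_{s'}$ on a transition to $s'$. **Theorem 3 (Bicriteria).** Let $m\ge0$ be fixed. For every SR criterion $C$ with functions $(f,g)$, every caMDP $M$ with $m$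 costs, every $B\in\mathbb R^m$ and every $\varepsilon>0$, Algorithm Bicriteria with $\ell=\varepsilon/(1+(S+1)H)$ is a $(0,\varepsilon)$-bicriteria: either it reports "Infeasible", and then no $\pi\in\Pi^D$ satisfies $C^\pi_M\le B$; or the policy that it outputs is a $\pi\in\Pi^D$ with $V^\pi_M\ge V^*$ and $C^\pi_M\le B+\varepsilon$. In the unit-cost model, in which every arithmetic operation, comparison and rounding of a number, every computed coordinate of a value of $f$ or $g$, and every access to the input costs one step, and a table access costs one step plus one for each number in its index, its running time is $$O\Bigl(H^{6m+1}S^{4m+2}A\,\max\bigl\{1,\|c_{\max}-c_{\min}\|_\infty/\varepsilon\bigr\}^{3m}\Bigr),$$ with a constant that depends on $m$ only. In particular, for costs that are polynomially bounded, i.e. $\|c_{\max}-c_{\min}\|_\infty\le p(|M|)$ for a fixed polynomial $p$ in the description size $|M|\ge HSA$, the running time is bounded by a polynomial in $|M|+1/\varepsilon$, which depends only on $m$ and $p$. -/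

import Mathlib

open scoped BigOperators

namespace CMDP

/-! ## Cost-accumulating MDPs, deterministic policies, values -/

/-- Vectors of `m` reals; `‖·‖` is the infinity norm and `≤` is componentwise. -/
abbrev Vec (m : ℕ) : Type := Fin m → ℝ

/-- A finite-horizon tabular cost-accumulating MDP with `m` costs. Time is indexed from `0`, so
that `h : Fin H` is the `(h+1)`-st step. `r` is the expected reward and `c` the (deterministic)
immediate cost vector; only the data at available actions `a ∈ act h s` matter. -/
structure CaMDP (m : ℕ) where
  H : ℕ
  S : ℕ
  A : ℕ
  H_pos : 0 < H
  act : Fin H → Fin S → Finset (Fin A)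
  act_nonempty : ∀ h s, (act h s).Nonempty
  P : Fin H → Fin S → Fin A → Fin S → ℝ
  P_mem : ∀ h s, ∀ a ∈ act h s, P h s a ∈ stdSimplex ℝ (Fin S)
  r : Fin H → Fin S → Fin A → ℝ
  c : Fin H → Fin S → Fin A → Vec m
  s₀ : Fin S

variable {m : ℕ}

/-- The past `(s_1, a_1, …, s_{h-1}, a_{h-1})` of a history; a history is a past together with the
current state `s_h`. (Costs are deterministic, so they carry no further information.) -/
abbrev CaMDP.Past (M : CaMDP m) : Type := List (Fin M.S × Fin M.A)

/-- Deterministic history-dependent policies; the time step is the length of the past. -/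
structure Policy (M : CaMDP m) where
  act : M.Past → Fin M.S → Fin M.A
  mem : ∀ (τ : M.Past) (s : Fin M.S) (h : τ.length < M.H), act τ s ∈ M.act ⟨τ.length, h⟩ s

namespace Policy

variable {M : CaMDP m}

/-- The past at step `k` when the states visited are `x` and the actions follow `π`. -/
def past (π : Policy M) (x : Fin (M.H + 1) → Fin M.S) : (k : ℕ) → k ≤ M.H → M.Past
  | 0, _ => []
  | k + 1, hk =>
    past π x k (by omega) ++
      [(x ⟨k, by omega⟩, π.act (past π x k (by omega)) (x ⟨k, by omega⟩))]

/-- The action taken at step `h` along the state trajectory `x`. -/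
def actionAt (π : Policy M) (x : Fin (M.H + 1) → Fin M.S) (h : Fin M.H) : Fin M.A :=
  π.act (π.past x h.1 h.2.le) (x h.castSucc)

/-- The probability, under the interaction of `π` with `M`, of the state trajectory `x`. -/
noncomputable def trajProb (π : Policy M) (x : Fin (M.H + 1) → Fin M.S) : ℝ :=
  (if x 0 = M.s₀ then 1 else 0) *
    ∏ h : Fin M.H, M.P h (x h.castSucc) (π.actionAt x h) (x h.succ)

/-- The value of `π`: the expectation of the total reward under the law of the interaction. -/
noncomputable def value (π : Policy M) : ℝ :=
  ∑ x : Fin (M.H + 1) → Fin M.S,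
    π.trajProb x * ∑ h : Fin M.H, M.r h (x h.castSucc) (π.actionAt x h)

end Policy

/-! ## Shortly recursive cost criteria -/

/-- A cost criterion assigns to a caMDP and a (deterministic) policy a vector of costs. -/
abbrev CostCriterion (m : ℕ) : Type := (M : CaMDP m) → Policy M → Vec m

/-- `f_{s'} g(p s') x_{s'}`, with `f_{s'}` the finite extension of `f` (in the order of the states)
and `g(p s')` multiplied componentwise. -/
noncomputable def weightedComb (f : Vec m → Vec m → Vec m) (g : ℝ → Vec m) {n : ℕ}
    (p : Fin n → ℝ) (x : Fin n → Vec m) : Vec m :=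
  (List.ofFn fun s' => g (p s') * x s').foldl f 0

/-- The requirements on the pair `(f, g)` of a shortly recursive criterion. Short maps are
`1`-Lipschitz maps for the infinity norm. -/
structure IsShortPair (f : Vec m → Vec m → Vec m) (g : ℝ → Vec m) : Prop where
  assoc : ∀ x y z, f (f x y) z = f x (f y z)
  mono : ∀ x x' y y', x ≤ x' → y ≤ y' → f x y ≤ f x' y'
  short_left : ∀ y, LipschitzWith 1 fun x => f x y
  short_right : ∀ x, LipschitzWith 1 fun y => f x y
  zero_left : ∀ x, f 0 x = x
  zero_right : ∀ x, f x 0 = x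
  g_mem : ∀ p ∈ Set.Icc (0 : ℝ) 1, ∀ i, g p i ∈ Set.Icc (0 : ℝ) 1
  g_zero : g 0 = 0
  short_comb : ∀ (n : ℕ) (p : Fin n → ℝ), p ∈ stdSimplex ℝ (Fin n) →
    LipschitzWith 1 fun x : Fin n → Vec m => weightedComb f g p x

/-- `C` is shortly recursive, with recursion functions `(f, g)`. -/
def IsSR (C : CostCriterion m) (f : Vec m → Vec m → Vec m) (g : ℝ → Vec m) : Prop :=
  IsShortPair f g ∧
  ∀ (M : CaMDP m) (π : Policy M), ∃ Ch : M.Past → Fin M.S → Vec m,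
    C M π = Ch [] M.s₀ ∧
    (∀ τ s, τ.length = M.H → Ch τ s = 0) ∧
    ∀ (τ : M.Past) (s : Fin M.S) (h : τ.length < M.H),
      Ch τ s = M.c ⟨τ.length, h⟩ s (π.act τ s) +
        weightedComb f g (M.P ⟨τ.length, h⟩ s (π.act τ s))
          fun s' => Ch (τ ++ [(s, π.act τ s)]) s'

/-- The optimum of the constrained problem: maximise the value over deterministic policies of cost
at most `B`; it is `⊥ = -∞` if there are none. -/
noncomputable def optValue (C : CostCriterion m) (M : CaMDP m) (B : Vec m) : EReal :=
  ⨆ (π : Policy M) (_ : C M π ≤ B), (π.value : EReal)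

/-- The constrained problem has a feasible deterministic policy. -/
def Feasible (C : CostCriterion m) (M : CaMDP m) (B : Vec m) : Prop :=
  ∃ π : Policy M, C M π ≤ B

/-- `(α, β)`-additive bicriteria approximations. -/
def IsBicriteriaApprox (α β : ℝ) (C : CostCriterion m) (M : CaMDP m) (B : Vec m)
    (π : Policy M) : Prop :=
  optValue C M B - (α : EReal) ≤ (π.value : EReal) ∧ ∀ i, C M π i ≤ B i + β

namespace CaMDP

/-- The values of the `i`-th immediate cost at available actions, and `0`. -/
noncomputable def costValues (M : CaMDP m) (i : Fin m) : Finset ℝ :=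
  insert 0 (((Finset.univ : Finset (Fin M.H × Fin M.S × Fin M.A)).filter
    fun q => q.2.2 ∈ M.act q.1 q.2.1).image fun q => M.c q.1 q.2.1 q.2.2 i)

/-- Componentwise largest immediate cost (at least `0`). -/
noncomputable def cMax (M : CaMDP m) : Vec m :=
  fun i => (M.costValues i).max' (Finset.insert_nonempty _ _)

/-- Componentwise smallest immediate cost (at most `0`). -/
noncomputable def cMin (M : CaMDP m) : Vec m :=
  fun i => (M.costValues i).min' (Finset.insert_nonempty _ _)

/-- The number of (time, state, action) triples; a tabular description has at least this size. -/
def tableSize (M : CaMDP m) : ℕ := M.H * M.S * M.A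

end CaMDP

/-! ## The cost model

Programs are written in a monad that counts steps. One step is charged for every arithmetic
operation, comparison or rounding of a number (so `m` for a componentwise operation on vectors and
for an evaluation of `f` or `g`), for every access to the input, for every loop iteration, and
`w + 1` steps for every access to a table whose indices consist of `w` numbers. -/

/-- A result together with the number of steps spent on it. -/
structure Timed (α : Type) where
  val : α
  steps : ℕ

namespace Timed

instance : Monad Timed where
  pure x := ⟨x, 0⟩
  bind x k := ⟨(k x.val).val, x.steps + (k x.val).steps⟩

/-- Return `x`, spending `n` steps. -/
def charge {α : Type} (n : ℕ) (x : α) : Timed α := ⟨x, n⟩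

/-- One elementary operation. -/
def op {α : Type} (x : α) : Timed α := charge 1 x

/-- One elementary operation for each of the `m` coordinates. -/
def vec {α : Type} {m : ℕ} (x : Fin m → α) : Timed (Fin m → α) := charge m x

/-- Run `body` for the elements of the list in turn, updating the state. -/
def loop {ι σ : Type} : List ι → (ι → σ → Timed σ) → σ → Timed σ
  | [], _, st => charge 1 st
  | i :: l, body, st => do
    let st ← body i st
    let st ← op st
    loop l body st

end Timed

/-- Tables (arrays, partially filled). -/
abbrev Table (ι β : Type) : Type := ι → Option β

namespace Table

variable {ι β : Type}

/-- The table without entries. -/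
def empty : Table ι β := fun _ => none

/-- Read an entry; `w` is the number of numbers in the index. -/
def read (w : ℕ) (T : Table ι β) (i : ι) : Timed (Option β) := Timed.charge (w + 1) (T i)

/-- Write an entry; `w` is the number of numbers in the index. -/
def write [DecidableEq ι] (w : ℕ) (T : Table ι β) (i : ι) (x : β) : Timed (Table ι β) :=
  Timed.charge (w + 1) (Function.update T i (some x))

end Table

/-! ## The algorithm

Budgets and partial costs are vectors of integer multiples of the unit `ℓ`; they are stored as
vectors of integers, `k` standing for the real vector `k ℓ`. -/

/-- Vectors of integer multiples of the unit. -/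
abbrev Key (m : ℕ) : Type := Fin m → ℤ

/-- The table of the values `V_h(s, b)`, indexed by `(h, s, b)`, with `h = H` for the base case. -/
abbrev ValueTable (M : CaMDP m) : Type := Table (ℕ × Fin M.S × Key m) EReal

/-- A budget-augmented policy: `(h, s, b)` is mapped to an action and a budget for each next state.
-/
abbrev AugPolicy (M : CaMDP m) : Type :=
  Table (ℕ × Fin M.S × Key m) (Fin M.A × Table (Fin M.S) (Key m))

/-- The table of the inner dynamic program: `(t, F)` is mapped to the optimal value and to a
maximising budget for the `t`-th next state. -/
abbrev DPTable (m : ℕ) : Type := Table (ℕ × Key m) (EReal × Key m)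

/-- Keep the candidate of larger value. -/
noncomputable def keepBetter {α : Type} (best : Option (EReal × α)) (x : EReal × α) :
    Timed (Option (EReal × α)) :=
  Timed.op <| match best with
    | none => some x
    | some y => if y.1 < x.1 then some x else some y

/-- Lower and upper bounds, around `0`, for all immediate costs. -/
noncomputable def costRange (M : CaMDP m) : Timed (ℝ × ℝ) :=
  Timed.loop (List.finRange M.H) (fun h =>
    Timed.loop (List.finRange M.S) (fun s =>
      Timed.loop (List.finRange M.A) (fun a st => do
        let ok ← Timed.op (decide (a ∈ M.act h s))
        if ok then
          Timed.loop (List.finRange m) (fun i st => do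
            let x ← Timed.op (M.c h s a i)
            let lo ← Timed.op (min st.1 x)
            let hi ← Timed.op (max st.2 x)
            pure (lo, hi)) st
        else pure st))) (0, 0)

/-- All integer vectors with entries in `[lo, hi]`. -/
noncomputable def box (m : ℕ) (lo hi : ℤ) : List (Key m) :=
  (Fintype.piFinset fun _ : Fin m => Finset.Icc lo hi).toList

/-- The set of the rounded budgets, `{⌈b/ℓ⌉ ℓ : b ∈ [b_min, b_max]^m}`, where `b_min` and `b_max`
are `H` times the smallest and the largest immediate cost. -/
noncomputable def budgetGrid (M : CaMDP m) (ℓ : ℝ) : Timed (List (Key m)) := do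
  let range ← costRange M
  let bmin ← Timed.op (M.H * range.1)
  let bmax ← Timed.op (M.H * range.2)
  let x ← Timed.op (bmin / ℓ)
  let lo ← Timed.op ⌈x⌉
  let y ← Timed.op (bmax / ℓ)
  let hi ← Timed.op ⌈y⌉
  Timed.charge ((m + 1) * ((box m lo hi).length + 1)) (box m lo hi)

section

variable (M : CaMDP m) (f : Vec m → Vec m → Vec m) (g : ℝ → Vec m) (ℓ : ℝ)
  (h : Fin M.H) (s : Fin M.S) (a : Fin M.A)

/-- The next rounded partial cost `⌈f(F, g(P_h(t ∣ s, a)) b)⌉`, rounded up to a multiple of `ℓ`. -/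
noncomputable def nextPartial (t : Fin M.S) (F b : Key m) : Timed (Key m) := do
  let p ← Timed.op (M.P h s a t)
  let w ← Timed.vec (g p)
  let x ← Timed.vec fun i => (b i : ℝ) * ℓ
  let y ← Timed.vec fun i => w i * x i
  let u ← Timed.vec fun i => (F i : ℝ) * ℓ
  let z ← Timed.vec (f u y)
  let q ← Timed.vec fun i => z i / ℓ
  Timed.vec fun i => ⌈q i⌉

/-- The forward recursion for the partial costs that can occur before each next state: layer `0`
is `{0}`, and layer `t + 1` consists of the successors of the elements of layer `t`, without
repetitions. -/
noncomputable def forwardSets (Bhat : List (Key m)) : Timed (Table ℕ (List (Key m))) := do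
  let init ← Table.write 1 Table.empty 0 [(0 : Key m)]
  Timed.loop (List.finRange M.S) (fun t layers => do
    let L ← Table.read 1 layers t.1
    let res ← Timed.loop (L.getD []) (fun F =>
      Timed.loop Bhat (fun b (st : List (Key m) × Table (Key m) Unit) => do
        let F' ← nextPartial M f g ℓ h s a t F b
        let old ← Table.read m st.2 F'
        match old with
        | some _ => pure st
        | none => do
          let seen ← Table.write m st.2 F' ()
          Timed.op (F' :: st.1, seen))) ([], Table.empty)
    Table.write 1 layers (t.1 + 1) res.1) init

/-- The approximate dynamic program over the next states, for the budget `b`, solved from the last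
next state to the first. -/
noncomputable def approxDP (b : Key m) (Bhat : List (Key m)) (V : ValueTable M)
    (layers : Table ℕ (List (Key m))) : Timed (DPTable m) := do
  let bl ← Timed.vec fun i => (b i : ℝ) * ℓ
  let n1 ← Timed.op ((M.S : ℝ) + 1)
  let slack ← Timed.op (ℓ * n1)
  let thr ← Timed.vec fun i => bl i + slack
  let L ← Table.read 1 layers M.S
  let base ← Timed.loop (L.getD []) (fun F (T : DPTable m) => do
    let x ← Timed.vec fun i => (F i : ℝ) * ℓ
    let y ← Timed.vec fun i => M.c h s a i + x i
    let ok ← Timed.charge m (decide (∀ i, y i ≤ thr i))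
    Table.write (m + 1) T (M.S, F) (if ok then 0 else ⊥, 0)) Table.empty
  Timed.loop (List.finRange M.S).reverse (fun t T => do
    let L ← Table.read 1 layers t.1
    Timed.loop (L.getD []) (fun F (T : DPTable m) => do
      let best ← Timed.loop Bhat (fun b' best => do
        let v ← Table.read (m + 2) V (h.1 + 1, t, b')
        let p ← Timed.op (M.P h s a t)
        let pv ← Timed.op ((p : EReal) * v.getD ⊥)
        let F' ← nextPartial M f g ℓ h s a t F b'
        let rest ← Table.read (m + 1) T (t.1 + 1, F')
        let tot ← Timed.op (pv + (rest.getD (⊥, 0)).1)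
        keepBetter best (tot, b')) none
      Table.write (m + 1) T (t.1, F) (best.getD (⊥, 0))) T) base

/-- Read the maximising vector of budgets off the table of the dynamic program. -/
noncomputable def recoverBudgets (T : DPTable m) : Timed (Table (Fin M.S) (Key m)) := do
  let res ← Timed.loop (List.finRange M.S)
    (fun t (st : Key m × Table (Fin M.S) (Key m)) => do
      let e ← Table.read (m + 1) T (t.1, st.1)
      let F' ← nextPartial M f g ℓ h s a t st.1 (e.getD (⊥, 0)).2
      let w ← Table.write 1 st.2 t (e.getD (⊥, 0)).2
      pure (F', w)) (0, Table.empty)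
  pure res.2

/-- The approximate update at `(h, (s, b))`: the value, a maximising action, and the budgets. -/
noncomputable def approxUpdate (b : Key m) (Bhat : List (Key m)) (V : ValueTable M) :
    Timed (Option (EReal × Fin M.A × Table (Fin M.S) (Key m))) := do
  let best ← Timed.loop (List.finRange M.A)
    (fun a (best : Option (EReal × Fin M.A × DPTable m)) => do
      let ok ← Timed.op (decide (a ∈ M.act h s))
      if ok then do
        let layers ← forwardSets M f g ℓ h s a Bhat
        let T ← approxDP M f g ℓ h s a b Bhat V layers
        let x ← Table.read (m + 1) T (0, 0)
        let tot ← Timed.op ((M.r h s a : EReal) + (x.getD (⊥, 0)).1)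
        keepBetter best (tot, a, T)
      else pure best) none
  match best with
  | none => pure none
  | some (v, a, T) => do
    let w ← recoverBudgets M f g ℓ h s a T
    pure (some (v, a, w))

end

/-- Approximate backward induction on the states augmented with the budgets in `Bhat` and, at the
first step, also with the initial budget `b₀`. -/
noncomputable def approxBackwardInduction (M : CaMDP m) (f : Vec m → Vec m → Vec m) (g : ℝ → Vec m)
    (ℓ : ℝ) (Bhat : List (Key m)) (b₀ : Key m) : Timed (ValueTable M × AugPolicy M) := do
  let V ← Timed.loop (List.finRange M.S) (fun s =>
    Timed.loop Bhat (fun b (V : ValueTable M) => do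
      let ok ← Timed.charge m (decide (∀ i, 0 ≤ b i))
      Table.write (m + 2) V (M.H, s, b) (if ok then 0 else ⊥))) Table.empty
  Timed.loop (List.finRange M.H).reverse (fun h st => do
    let budgets ← Timed.op (if h.1 = 0 then b₀ :: Bhat else Bhat)
    Timed.loop (List.finRange M.S) (fun s =>
      Timed.loop budgets (fun b (st : ValueTable M × AugPolicy M) => do
        let u ← approxUpdate M f g ℓ h s b Bhat st.1
        match u with
        | none => pure st
        | some (v, a, w) => do
          let V ← Table.write (m + 2) st.1 (h.1, s, b) v
          let Q ← Table.write (m + 2) st.2 (h.1, s, b) (a, w)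
          pure (V, Q))) st) (V, Table.empty)

/-- Round a vector of reals up to multiples of `ℓ`. -/
noncomputable def roundUp (ℓ : ℝ) (B : Vec m) : Key m := fun i => ⌈B i / ℓ⌉

/-- The algorithm Bicriteria with rounding unit `ℓ`. The output `none` means "Infeasible". -/
noncomputable def bicriteria (M : CaMDP m) (f : Vec m → Vec m → Vec m) (g : ℝ → Vec m)
    (B : Vec m) (ℓ : ℝ) : Timed (Option (AugPolicy M)) := do
  let Bhat ← budgetGrid M ℓ
  let b₀ ← Timed.charge (2 * m) (roundUp ℓ B)
  let res ← approxBackwardInduction M f g ℓ Bhat b₀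
  let v ← Table.read (m + 2) res.1 (0, M.s₀, b₀)
  let bad ← Timed.op (decide (v.getD ⊥ = ⊥))
  pure (if bad then none else some res.2)

/-! ## Deploying a budget-augmented policy -/

/-- The action chosen after visiting the state `s` with budget `b` at step `k` and then the states
in the list; the budget is replaced, at each transition, by the one chosen for the new state. -/
def runAug {M : CaMDP m} (Q : AugPolicy M) :
    ℕ → Key m → Fin M.S → List (Fin M.S) → Option (Fin M.A)
  | k, b, s, [] => (Q (k, s, b)).map Prod.fst
  | k, b, s, s' :: l =>
    match (Q (k, s, b)).bind fun e => e.2 s' with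
    | none => none
    | some b' => runAug Q (k + 1) b' s' l

/-- The action that the augmented interaction, started with budget `b₀`, takes at the history
`(τ, s)`. -/
def deploy {M : CaMDP m} (Q : AugPolicy M) (b₀ : Key m) (τ : M.Past) (s : Fin M.S) :
    Option (Fin M.A) :=
  match τ.map Prod.fst ++ [s] with
  | [] => none
  | s₁ :: l => runAug Q 0 b₀ s₁ l

/-- `π` is the deterministic policy of `M` that is executed when `Q` is deployed. -/
def Deploys {M : CaMDP m} (Q : AugPolicy M) (b₀ : Key m) (π : Policy M) : Prop :=
  ∀ (τ : M.Past) (s : Fin M.S), τ.length < M.H → deploy Q b₀ τ s = some (π.act τ s)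

/-- The rounding unit `ε / (1 + (S + 1) H)`. -/
noncomputable def unit (M : CaMDP m) (ε : ℝ) : ℝ := ε / (1 + ((M.S : ℝ) + 1) * M.H)

end CMDP

/-!
Along a policy `π`, let every next state receive as its budget the exact remaining cost of `π`,
rounded up to a multiple of the unit `ℓ`. These budgets are on the grid, because a weighted
combination of the remaining costs stays in every interval around `0` that contains them
(`IsShortPair.weightedComb_mem_Icc`; the weights `g p` need not sum to `1`, so this uses
monotonicity and shortness). Rounding the budgets moves the combination by at most `ℓ`, since it is
a short map, and rounding after each of the `S` partial combinations by at most `S ℓ`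
(`IsShortPair.roundedPrefix_bounds`). The slack `(S + 1) ℓ` of the algorithm absorbs both, so these
budgets are among its options, and the computed value is at least the value of any feasible policy
(`valueFrom_le`). In particular there is no feasible policy if it is `⊥`.

Conversely, where the computed value is finite, the deployed policy attains it, and every step
overdraws its budget by at most the slack (`deployed_value_and_cost`). Successors of probability
`0` may have the value `⊥`, but they contribute neither to the value, as `0 * ⊥ = 0`, nor to the
cost, as `g 0 = 0`. Over `H` steps, together with the rounding of the initial budget, the cost
exceeds `B` by at most `(1 + (S + 1) H) ℓ = ε`.

For the running time, a partial combination is a full one with the later components set to `0`, so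
the rounded partial costs obey, up to `S` roundings, the same bound as a single rounded budget
(`length_layer_le`). Hence one number `N`, of order at most `(H² S max(1, ‖c_max - c_min‖ / ε))^m`,
bounds both the size of the grid and the size of every layer of the inner dynamic program
(`keyBound_unit_le`), and the nested loops take a number of steps of order at most `H S² A N³`
(`steps_bicriteria_le`).
-/

namespace CMDP

variable {m : ℕ}

/-! ### Runs of the step-counting monad -/

namespace Timed

variable {α β ι σ : Type}

@[simp] theorem val_bind (x : Timed α) (k : α → Timed β) : (x >>= k).val = (k x.val).val := rfl

@[simp] theorem steps_bind (x : Timed α) (k : α → Timed β) :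
    (x >>= k).steps = x.steps + (k x.val).steps := rfl

@[simp] theorem val_pure (x : α) : (pure x : Timed α).val = x := rfl

@[simp] theorem steps_pure (x : α) : (pure x : Timed α).steps = 0 := rfl

@[simp] theorem val_charge (n : ℕ) (x : α) : (charge n x).val = x := rfl

@[simp] theorem steps_charge (n : ℕ) (x : α) : (charge n x).steps = n := rfl

@[simp] theorem val_op (x : α) : (op x).val = x := rfl

@[simp] theorem steps_op (x : α) : (op x).steps = 1 := rfl

@[simp] theorem val_vec (x : Fin m → α) : (vec x).val = x := rfl

@[simp] theorem steps_vec (x : Fin m → α) : (vec x).steps = m := rfl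

@[simp] theorem loop_nil (body : ι → σ → Timed σ) (st : σ) : loop [] body st = charge 1 st := rfl

theorem val_loop_cons (i : ι) (l : List ι) (body : ι → σ → Timed σ) (st : σ) :
    (loop (i :: l) body st).val = (loop l body (body i st).val).val := rfl

theorem steps_loop_cons (i : ι) (l : List ι) (body : ι → σ → Timed σ) (st : σ) :
    (loop (i :: l) body st).steps =
      (body i st).steps + (1 + (loop l body (body i st).val).steps) := rfl

/-- Loop invariants: `I pre st` speaks of the state `st` once the elements of `pre` have been
processed. -/
theorem loop_invariant (l : List ι) (body : ι → σ → Timed σ) (st : σ) (I : List ι → σ → Prop)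
    (h0 : I [] st)
    (hstep : ∀ pre i suf st, l = pre ++ i :: suf → I pre st → I (pre ++ [i]) (body i st).val) :
    I l (loop l body st).val := by
  suffices H : ∀ (suf pre : List ι) (st : σ), l = pre ++ suf → I pre st →
      I l (loop suf body st).val from H l [] st rfl h0
  intro suf
  induction suf with
  | nil =>
    intro pre st hl hI
    rw [List.append_nil] at hl
    subst hl
    exact hI
  | cons i suf ih =>
    intro pre st hl hI
    rw [val_loop_cons]
    exact ih (pre ++ [i]) _ (by simpa using hl) (hstep pre i suf st hl hI)

/-- Loop invariants that do not mention the elements processed so far. -/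
theorem loop_invariant_const (l : List ι) (body : ι → σ → Timed σ) (st : σ) (I : σ → Prop)
    (h0 : I st) (hstep : ∀ i ∈ l, ∀ st, I st → I (body i st).val) :
    I (loop l body st).val :=
  loop_invariant l body st (fun _ => I) h0 fun pre i suf st hl h =>
    hstep i (by simp [hl]) st h

theorem loop_steps_le_of_invariant (l : List ι) (body : ι → σ → Timed σ) (st : σ)
    (I : σ → Prop) {n c : ℕ} (hn : l.length ≤ n) (hn1 : 1 ≤ n) (h0 : I st)
    (hI : ∀ i ∈ l, ∀ st, I st → I (body i st).val)
    (hc : ∀ i ∈ l, ∀ st, I st → (body i st).steps ≤ c) :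
    (loop l body st).steps ≤ n * (c + 2) := by
  have key : (loop l body st).steps ≤ l.length * (c + 1) + 1 := by
    clear hn
    induction l generalizing st with
    | nil => simp
    | cons i l ih =>
      have h1 := ih (body i st).val (hI i (by simp) st h0)
        (fun j hj => hI j (by simp [hj])) (fun j hj => hc j (by simp [hj]))
      have h2 := hc i (by simp) st h0
      rw [steps_loop_cons, List.length_cons, Nat.succ_mul]
      omega
  calc _ ≤ l.length * (c + 1) + 1 := key
    _ ≤ n * (c + 1) + n := by gcongr
    _ = n * (c + 2) := by ring

theorem loop_steps_le (l : List ι) (body : ι → σ → Timed σ) (st : σ) {n c : ℕ}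
    (hn : l.length ≤ n) (hn1 : 1 ≤ n) (hc : ∀ i ∈ l, ∀ st, (body i st).steps ≤ c) :
    (loop l body st).steps ≤ n * (c + 2) :=
  loop_steps_le_of_invariant l body st (fun _ => True) hn hn1 trivial (fun _ _ _ _ => trivial)
    fun i hi st _ => hc i hi st

end Timed

namespace Table

variable {ι β : Type}

@[simp] theorem val_read (w : ℕ) (T : Table ι β) (i : ι) : (T.read w i).val = T i := rfl

@[simp] theorem steps_read (w : ℕ) (T : Table ι β) (i : ι) : (T.read w i).steps = w + 1 := rfl

@[simp] theorem val_write [DecidableEq ι] (w : ℕ) (T : Table ι β) (i : ι) (x : β) :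
    (T.write w i x).val = Function.update T i (some x) := rfl

@[simp] theorem steps_write [DecidableEq ι] (w : ℕ) (T : Table ι β) (i : ι) (x : β) :
    (T.write w i x).steps = w + 1 := rfl

end Table

@[simp] theorem steps_keepBetter {α : Type} (best : Option (EReal × α)) (x : EReal × α) :
    (keepBetter best x).steps = 1 := rfl

/-- A loop over `l` that keeps the best of the candidates `cand i`, `i ∈ l`, and skips the
others, returns a best candidate. -/
theorem loop_keepBetter {ι α : Type} (l : List ι) (p : ι → Prop) (cand : ι → EReal × α)
    (body : ι → Option (EReal × α) → Timed (Option (EReal × α)))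
    (hbody : ∀ i st, p i → (body i st).val = (keepBetter st (cand i)).val)
    (hskip : ∀ i st, ¬ p i → (body i st).val = st) (hne : ∃ i ∈ l, p i) :
    ∃ i ∈ l, p i ∧ (Timed.loop l body none).val = some (cand i) ∧
      ∀ j ∈ l, p j → (cand j).1 ≤ (cand i).1 := by
  have key := Timed.loop_invariant l body none
    (fun pre st => (st = none ∧ ∀ i ∈ pre, ¬ p i) ∨
      ∃ i ∈ pre, p i ∧ st = some (cand i) ∧ ∀ j ∈ pre, p j → (cand j).1 ≤ (cand i).1)
    (Or.inl ⟨rfl, by simp⟩) ?_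
  · rcases key with ⟨_, h⟩ | h
    · obtain ⟨i, hi, hpi⟩ := hne
      exact absurd hpi (h i hi)
    · exact h
  · intro pre i suf st _ hI
    by_cases hp : p i
    · right
      rw [hbody i st hp]
      rcases hI with ⟨rfl, h⟩ | ⟨k, hk, hpk, rfl, hmax⟩
      · refine ⟨i, by simp, hp, rfl, fun j hj hpj => ?_⟩
        rcases List.mem_append.1 hj with hj | hj
        · exact absurd hpj (h j hj)
        · rw [List.mem_singleton.1 hj]
      · by_cases hlt : (cand k).1 < (cand i).1
        · refine ⟨i, by simp, hp, by simp [keepBetter, hlt], fun j hj hpj => ?_⟩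
          rcases List.mem_append.1 hj with hj | hj
          · exact (hmax j hj hpj).trans hlt.le
          · rw [List.mem_singleton.1 hj]
        · refine ⟨k, by simp [hk], hpk, by simp [keepBetter, hlt], fun j hj hpj => ?_⟩
          rcases List.mem_append.1 hj with hj | hj
          · exact hmax j hj hpj
          · rw [List.mem_singleton.1 hj]
            exact not_lt.1 hlt
    · rw [hskip i st hp]
      rcases hI with ⟨rfl, h⟩ | ⟨k, hk, hpk, rfl, hmax⟩
      · left
        refine ⟨rfl, fun j hj => ?_⟩
        rcases List.mem_append.1 hj with hj | hj
        · exact h j hj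
        · rwa [List.mem_singleton.1 hj]
      · right
        refine ⟨k, by simp [hk], hpk, rfl, fun j hj hpj => ?_⟩
        rcases List.mem_append.1 hj with hj | hj
        · exact hmax j hj hpj
        · rw [List.mem_singleton.1 hj] at hpj
          exact absurd hpj hp

/-! ### Policy evaluation -/

section PathSums

variable {X Y : Type}

/-- The past at step `k` along the trajectory `x`, continuing the past `τ` by the actions `act`. -/
def pastFrom (act : List (X × Y) → X → Y) (τ : List (X × Y)) {n : ℕ} (x : Fin (n + 1) → X) :
    (k : ℕ) → k ≤ n → List (X × Y)
  | 0, _ => τ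
  | k + 1, hk =>
    pastFrom act τ x k (by omega) ++
      [(x ⟨k, by omega⟩, act (pastFrom act τ x k (by omega)) (x ⟨k, by omega⟩))]

theorem length_pastFrom (act : List (X × Y) → X → Y) (τ : List (X × Y)) {n : ℕ}
    (x : Fin (n + 1) → X) (k : ℕ) (hk : k ≤ n) :
    (pastFrom act τ x k hk).length = τ.length + k := by
  induction k with
  | zero => rfl
  | succ k ih => simp [pastFrom, ih (by omega), Nat.add_assoc]

theorem pastFrom_cons (act : List (X × Y) → X → Y) (τ : List (X × Y)) {n : ℕ} (s : X)
    (y : Fin (n + 1) → X) (k : ℕ) (hk : k + 1 ≤ n + 1) :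
    pastFrom act τ (Fin.cons s y : Fin (n + 1 + 1) → X) (k + 1) hk =
      pastFrom act (τ ++ [(s, act τ s)]) y k (by omega) := by
  induction k with
  | zero => rfl
  | succ k ih =>
    rw [pastFrom, ih (by omega)]
    rfl

/-- The expected total reward over `n` steps after the past `τ`, in the state `s`, by recursion on
the remaining steps. The transition weights and the rewards depend on the past. -/
def sumFrom [Fintype X] (act : List (X × Y) → X → Y) (K : List (X × Y) → X → X → ℝ)
    (R : List (X × Y) → X → ℝ) : ℕ → List (X × Y) → X → ℝ
  | 0, _, _ => 0
  | n + 1, τ, s => R τ s + ∑ s', K τ s s' * sumFrom act K R n (τ ++ [(s, act τ s)]) s'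

theorem sum_path_cons [Fintype X] [DecidableEq X] {n : ℕ} (s : X) (φ : (Fin (n + 1 + 1) → X) → ℝ) :
    ∑ x : Fin (n + 1 + 1) → X, (if x 0 = s then 1 else 0) * φ x =
      ∑ y : Fin (n + 1) → X, φ (Fin.cons s y) := by
  rw [← (Fin.consEquiv fun _ => X).sum_comp, Fintype.sum_prod_type, Finset.sum_eq_single s]
  · simp [Fin.consEquiv]
  · intro t _ ht
    simp [Fin.consEquiv, ht]
  · simp

theorem sum_split_start [Fintype X] [DecidableEq X] {n : ℕ} (φ : (Fin (n + 1) → X) → ℝ) :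
    ∑ y, φ y = ∑ s' : X, ∑ y : Fin (n + 1) → X, (if y 0 = s' then 1 else 0) * φ y := by
  rw [Finset.sum_comm]
  simp

theorem sum_pathWeight [Fintype X] [DecidableEq X] (act : List (X × Y) → X → Y)
    (K : List (X × Y) → X → X → ℝ) {N : ℕ} (hK : ∀ τ s, τ.length < N → ∑ s', K τ s s' = 1)
    (n : ℕ) (τ : List (X × Y)) (s : X) (hn : τ.length + n ≤ N) :
    ∑ x : Fin (n + 1) → X, (if x 0 = s then 1 else 0) *
      ∏ h : Fin n, K (pastFrom act τ x h.1 h.2.le) (x h.castSucc) (x h.succ) = 1 := by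
  induction n generalizing τ s with
  | zero =>
    rw [← (Equiv.funUnique (Fin 1) X).symm.sum_comp]
    simp
  | succ n ih =>
    rw [sum_path_cons, sum_split_start]
    have : ∀ s' : X, ∑ y : Fin (n + 1) → X, (if y 0 = s' then 1 else 0) *
        ∏ h : Fin (n + 1), K (pastFrom act τ (Fin.cons s y : Fin (n + 1 + 1) → X) h.1 h.2.le)
          ((Fin.cons s y : Fin (n + 1 + 1) → X) h.castSucc)
          ((Fin.cons s y : Fin (n + 1 + 1) → X) h.succ) = K τ s s' := by
      intro s'
      have h1 := ih (τ ++ [(s, act τ s)]) s' (by simp; omega)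
      refine Eq.trans ?_ ((congrArg (K τ s s' * ·) h1).trans (mul_one _))
      simp only [Finset.mul_sum]
      refine Finset.sum_congr rfl fun y _ => ?_
      by_cases hy : y 0 = s'
      · have hp : ∀ h : Fin n, pastFrom act τ (Fin.cons s y : Fin (n + 1 + 1) → X) (h.1 + 1)
            (by omega) = pastFrom act (τ ++ [(s, act τ s)]) y h.1 h.2.le :=
          fun h => pastFrom_cons act τ s y h.1 (by omega)
        rw [Fin.prod_univ_succ]
        simp only [hy, if_true, one_mul, Fin.cons_succ, Fin.val_succ, hp]
        rfl
      · simp [hy]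
    rw [Finset.sum_congr rfl fun s' _ => this s']
    exact hK τ s (by omega)

/-- Summing over trajectories agrees with the recursion over the remaining steps. -/
theorem sum_path_eq_sumFrom [Fintype X] [DecidableEq X] (act : List (X × Y) → X → Y)
    (K : List (X × Y) → X → X → ℝ) (R : List (X × Y) → X → ℝ) {N : ℕ}
    (hK : ∀ τ s, τ.length < N → ∑ s', K τ s s' = 1) (n : ℕ)
    (τ : List (X × Y)) (s : X) (hn : τ.length + n ≤ N) :
    ∑ x : Fin (n + 1) → X, ((if x 0 = s then 1 else 0) *
      ∏ h : Fin n, K (pastFrom act τ x h.1 h.2.le) (x h.castSucc) (x h.succ)) *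
        ∑ h : Fin n, R (pastFrom act τ x h.1 h.2.le) (x h.castSucc) = sumFrom act K R n τ s := by
  induction n generalizing τ s with
  | zero => simp [sumFrom]
  | succ n ih =>
    simp only [mul_assoc]
    rw [sum_path_cons, sum_split_start]
    have : ∀ s' : X, ∑ y : Fin (n + 1) → X, (if y 0 = s' then 1 else 0) *
        ((∏ h : Fin (n + 1), K (pastFrom act τ (Fin.cons s y : Fin (n + 1 + 1) → X) h.1 h.2.le)
          ((Fin.cons s y : Fin (n + 1 + 1) → X) h.castSucc)
          ((Fin.cons s y : Fin (n + 1 + 1) → X) h.succ)) *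
        ∑ h : Fin (n + 1), R (pastFrom act τ (Fin.cons s y : Fin (n + 1 + 1) → X) h.1 h.2.le)
          ((Fin.cons s y : Fin (n + 1 + 1) → X) h.castSucc)) =
        K τ s s' * (R τ s + sumFrom act K R n (τ ++ [(s, act τ s)]) s') := by
      intro s'
      have h1 := ih (τ ++ [(s, act τ s)]) s' (by simp; omega)
      have h2 := sum_pathWeight act K hK n (τ ++ [(s, act τ s)]) s' (by simp; omega)
      have h3 : R τ s + sumFrom act K R n (τ ++ [(s, act τ s)]) s' =
          ∑ y : Fin (n + 1) → X, ((if y 0 = s' then 1 else 0) *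
            ∏ h : Fin n, K (pastFrom act (τ ++ [(s, act τ s)]) y h.1 h.2.le)
              (y h.castSucc) (y h.succ)) * (R τ s +
            ∑ h : Fin n, R (pastFrom act (τ ++ [(s, act τ s)]) y h.1 h.2.le) (y h.castSucc)) := by
        simp only [mul_add]
        rw [Finset.sum_add_distrib, h1, ← Finset.sum_mul, h2, one_mul]
      rw [h3, Finset.mul_sum]
      refine Finset.sum_congr rfl fun y _ => ?_
      by_cases hy : y 0 = s'
      · have hp : ∀ h : Fin n, pastFrom act τ (Fin.cons s y : Fin (n + 1 + 1) → X) (h.1 + 1)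
            (by omega) = pastFrom act (τ ++ [(s, act τ s)]) y h.1 h.2.le :=
          fun h => pastFrom_cons act τ s y h.1 (by omega)
        rw [Fin.prod_univ_succ, Fin.sum_univ_succ]
        simp only [hy, if_true, one_mul, Fin.cons_succ, ← mul_assoc, Fin.val_succ, hp]
        rfl
      · simp [hy]
    rw [Finset.sum_congr rfl fun s' _ => this s']
    simp only [mul_add]
    rw [Finset.sum_add_distrib, ← Finset.sum_mul, hK τ s (by omega), one_mul, sumFrom]

end PathSums

namespace Policy

variable {M : CaMDP m}

/-- The transition probabilities from the state `s` after the past `τ` when following `π`. -/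
noncomputable def step (π : Policy M) (τ : M.Past) (s s' : Fin M.S) : ℝ :=
  if h : τ.length < M.H then M.P ⟨τ.length, h⟩ s (π.act τ s) s' else 0

/-- The expected reward in the state `s` after the past `τ` when following `π`. -/
noncomputable def reward (π : Policy M) (τ : M.Past) (s : Fin M.S) : ℝ :=
  if h : τ.length < M.H then M.r ⟨τ.length, h⟩ s (π.act τ s) else 0

/-- The value `V^π_h(τ, s)` with `n` steps to go. -/
noncomputable def valueFrom (π : Policy M) : ℕ → M.Past → Fin M.S → ℝ :=
  sumFrom π.act π.step π.reward

theorem past_eq_pastFrom (π : Policy M) (x : Fin (M.H + 1) → Fin M.S) (k : ℕ) (hk : k ≤ M.H) :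
    π.past x k hk = pastFrom π.act [] x k hk := by
  induction k with
  | zero => rfl
  | succ k ih => rw [past, pastFrom, ih (by omega)]

theorem length_past (π : Policy M) (x : Fin (M.H + 1) → Fin M.S) (k : ℕ) (hk : k ≤ M.H) :
    (π.past x k hk).length = k := by
  rw [past_eq_pastFrom, length_pastFrom]
  simp

/-- Policy evaluation: the expectation over trajectories obeys the Bellman recursion. -/
theorem value_eq_valueFrom (π : Policy M) : π.value = π.valueFrom M.H [] M.s₀ := by
  rw [valueFrom, ← sum_path_eq_sumFrom π.act π.step π.reward (N := M.H) ?_ M.H [] M.s₀ (by simp)]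
  · refine Finset.sum_congr rfl fun x _ => ?_
    rw [trajProb]
    have hl : ∀ h : Fin M.H, (⟨(π.past x h.1 h.2.le).length, by
        rw [length_past]; exact h.2⟩ : Fin M.H) = h := fun h => Fin.ext (length_past π x _ _)
    congr 2
    · refine Finset.prod_congr rfl fun h _ => ?_
      rw [← past_eq_pastFrom, step, dif_pos (by rw [length_past]; exact h.2), hl]
      rfl
    · refine funext fun h => ?_
      rw [← past_eq_pastFrom, reward, dif_pos (by rw [length_past]; exact h.2), hl]
      rfl
  · intro τ s hτ
    simp only [step, dif_pos hτ]
    exact (M.P_mem _ _ _ (π.mem τ s hτ)).2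

theorem valueFrom_zero (π : Policy M) (τ : M.Past) (s : Fin M.S) : π.valueFrom 0 τ s = 0 := rfl

theorem valueFrom_succ (π : Policy M) (n : ℕ) (τ : M.Past) (s : Fin M.S) (h : τ.length < M.H) :
    π.valueFrom (n + 1) τ s = M.r ⟨τ.length, h⟩ s (π.act τ s) +
      ∑ s', M.P ⟨τ.length, h⟩ s (π.act τ s) s' * π.valueFrom n (τ ++ [(s, π.act τ s)]) s' := by
  rw [valueFrom, sumFrom, reward, dif_pos h]
  simp only [step, dif_pos h]

end Policy

/-! ### Short pairs and rounding -/

/-- The real vector that a vector of integers stands for. -/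
noncomputable def toVec (ℓ : ℝ) (k : Key m) : Vec m := fun i => (k i : ℝ) * ℓ

theorem le_toVec_roundUp {ℓ : ℝ} (hℓ : 0 < ℓ) (x : Vec m) (i : Fin m) :
    x i ≤ toVec ℓ (roundUp ℓ x) i := by
  rw [toVec, roundUp, ← div_le_iff₀ hℓ]
  exact Int.le_ceil _

theorem toVec_roundUp_le {ℓ : ℝ} (hℓ : 0 < ℓ) (x : Vec m) (i : Fin m) :
    toVec ℓ (roundUp ℓ x) i ≤ x i + ℓ := by
  have h := (Int.ceil_lt_add_one (x i / ℓ)).le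
  calc toVec ℓ (roundUp ℓ x) i ≤ (x i / ℓ + 1) * ℓ := by
        rw [toVec, roundUp]; gcongr
    _ = x i + ℓ := by field_simp

/-- The components `y 0, …, y (k - 1)` combined by the finite extension of `f`. -/
def prefixComb (f : Vec m → Vec m → Vec m) {n : ℕ} (y : Fin n → Vec m) (k : ℕ) : Vec m :=
  ((List.ofFn y).take k).foldl f 0

theorem prefixComb_succ (f : Vec m → Vec m → Vec m) {n : ℕ} (y : Fin n → Vec m) (k : ℕ)
    (hk : k < n) : prefixComb f y (k + 1) = f (prefixComb f y k) (y ⟨k, hk⟩) := by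
  have hk' : k < (List.ofFn y).length := by simpa using hk
  rw [prefixComb, List.take_add_one, List.getElem?_eq_getElem hk', prefixComb]
  simp

theorem weightedComb_eq_prefixComb (f : Vec m → Vec m → Vec m) (g : ℝ → Vec m) {n : ℕ}
    (p : Fin n → ℝ) (x : Fin n → Vec m) :
    weightedComb f g p x = prefixComb f (fun j => g (p j) * x j) n := by
  rw [weightedComb, prefixComb, List.take_of_length_le (by simp)]

/-- The rounded partial cost that follows `F` when the budget `b` is chosen for a next state of
probability `q`. -/
noncomputable def roundedStep (f : Vec m → Vec m → Vec m) (g : ℝ → Vec m) (ℓ q : ℝ)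
    (F b : Key m) : Key m :=
  roundUp ℓ (f (toVec ℓ F) (g q * toVec ℓ b))

/-- The rounded partial costs obtained from the budgets `β`. -/
noncomputable def roundedPrefix (f : Vec m → Vec m → Vec m) (g : ℝ → Vec m) (ℓ : ℝ) {n : ℕ}
    (p : Fin n → ℝ) (β : Fin n → Key m) : ℕ → Key m
  | 0 => 0
  | k + 1 =>
    if h : k < n then roundedStep f g ℓ (p ⟨k, h⟩) (roundedPrefix f g ℓ p β k) (β ⟨k, h⟩)
    else roundedPrefix f g ℓ p β k

namespace IsShortPair

variable {f : Vec m → Vec m → Vec m} {g : ℝ → Vec m}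

theorem apply_le_of_lipschitz {E : Type} [SeminormedAddCommGroup E] {φ : E → Vec m}
    (hφ : LipschitzWith 1 φ) (x y : E) {δ : ℝ} (h : ‖x - y‖ ≤ δ) (i : Fin m) :
    φ x i ≤ φ y i + δ := by
  have h1 := hφ.dist_le_mul x y
  rw [NNReal.coe_one, one_mul, dist_eq_norm, dist_eq_norm] at h1
  have h2 := norm_le_pi_norm (φ x - φ y) i
  have h3 := le_abs_self ((φ x - φ y) i)
  rw [Real.norm_eq_abs] at h2
  simp only [Pi.sub_apply] at h2 h3
  linarith

theorem norm_sub_le_of_abs {n : ℕ} (x y : Fin n → Vec m) {δ : ℝ} (hδ : 0 ≤ δ)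
    (h : ∀ j i, |x j i - y j i| ≤ δ) : ‖x - y‖ ≤ δ :=
  (pi_norm_le_iff_of_nonneg hδ).2 fun j => (pi_norm_le_iff_of_nonneg hδ).2 fun i => h j i

theorem prefixComb_mono (hfg : IsShortPair f g) {n : ℕ} (x y : Fin n → Vec m) (h : x ≤ y)
    (k : ℕ) (hk : k ≤ n) : prefixComb f x k ≤ prefixComb f y k := by
  induction k with
  | zero => exact le_rfl
  | succ k ih =>
    rw [prefixComb_succ f x k hk, prefixComb_succ f y k hk]
    exact hfg.mono _ _ _ _ (ih (by omega)) (h _)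

theorem prefixComb_zero_vec (hfg : IsShortPair f g) {n : ℕ} (k : ℕ) (hk : k ≤ n) :
    prefixComb f (fun _ : Fin n => (0 : Vec m)) k = 0 := by
  induction k with
  | zero => rfl
  | succ k ih => rw [prefixComb_succ f _ k hk, ih (by omega), hfg.zero_left]

/-- A partial combination is a full combination with the later components set to `0`. -/
theorem prefixComb_eq_mask (hfg : IsShortPair f g) {n : ℕ} (y : Fin n → Vec m) (k : ℕ)
    (hk : k ≤ n) :
    prefixComb f y k = prefixComb f (fun j => if j.1 < k then y j else 0) n := by
  have h1 : ∀ j ≤ k, prefixComb f (fun j => if j.1 < k then y j else 0) j = prefixComb f y j := by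
    intro j hj
    induction j with
    | zero => rfl
    | succ j ih =>
      rw [prefixComb_succ f _ j (by omega), prefixComb_succ f _ j (by omega), ih (by omega)]
      simp [show j < k by omega]
  have h2 : ∀ d, k + d ≤ n → prefixComb f (fun j => if j.1 < k then y j else 0) (k + d) =
      prefixComb f y k := by
    intro d hd
    induction d with
    | zero => exact h1 k le_rfl
    | succ d ih =>
      rw [← Nat.add_assoc, prefixComb_succ f _ (k + d) (by omega), ih (by omega)]
      simp [hfg.zero_right]
  rw [← h2 (n - k) (by omega)]
  congr 1
  omega

theorem g_nonneg (hfg : IsShortPair f g) {n : ℕ} {p : Fin n → ℝ} (hp : p ∈ stdSimplex ℝ (Fin n))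
    (j : Fin n) (i : Fin m) : 0 ≤ g (p j) i :=
  (hfg.g_mem _ (mem_Icc_of_mem_stdSimplex hp j) i).1

theorem weightedComb_mono (hfg : IsShortPair f g) {n : ℕ} {p : Fin n → ℝ}
    (hp : p ∈ stdSimplex ℝ (Fin n)) {x y : Fin n → Vec m} (h : x ≤ y) :
    weightedComb f g p x ≤ weightedComb f g p y := by
  rw [weightedComb_eq_prefixComb, weightedComb_eq_prefixComb]
  refine hfg.prefixComb_mono _ _ (fun j i => ?_) n le_rfl
  exact mul_le_mul_of_nonneg_left (h j i) (hfg.g_nonneg hp j i)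

theorem weightedComb_le_add (hfg : IsShortPair f g) {n : ℕ} {p : Fin n → ℝ}
    (hp : p ∈ stdSimplex ℝ (Fin n)) {x y : Fin n → Vec m} {δ : ℝ} (hδ : 0 ≤ δ)
    (h : ∀ j i, |x j i - y j i| ≤ δ) (i : Fin m) :
    weightedComb f g p x i ≤ weightedComb f g p y i + δ :=
  apply_le_of_lipschitz (hfg.short_comb n p hp) x y (norm_sub_le_of_abs x y hδ h) i

theorem weightedComb_zero (hfg : IsShortPair f g) {n : ℕ} (p : Fin n → ℝ) :
    weightedComb f g p 0 = 0 := by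
  rw [weightedComb_eq_prefixComb]
  simpa using hfg.prefixComb_zero_vec (n := n) n le_rfl

theorem abs_weightedComb_le (hfg : IsShortPair f g) {n : ℕ} {p : Fin n → ℝ}
    (hp : p ∈ stdSimplex ℝ (Fin n)) {x : Fin n → Vec m} {δ : ℝ} (hδ : 0 ≤ δ)
    (h : ∀ j i, |x j i| ≤ δ) (i : Fin m) : |weightedComb f g p x i| ≤ δ := by
  have h1 := hfg.weightedComb_le_add hp (x := x) (y := 0) hδ (by simpa using h) i
  have h2 := hfg.weightedComb_le_add hp (x := 0) (y := x) hδ (by simpa using h) i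
  rw [hfg.weightedComb_zero] at h1 h2
  rw [abs_le]
  simp only [Pi.zero_apply] at h1 h2
  constructor <;> linarith

/-- Although the weights need not sum to `1`, a weighted combination stays in every interval
around `0` that contains the components: by monotonicity, components of the other sign may be
replaced by `0`, and then shortness bounds the combination. -/
theorem weightedComb_mem_Icc (hfg : IsShortPair f g) {n : ℕ} {p : Fin n → ℝ}
    (hp : p ∈ stdSimplex ℝ (Fin n)) {x : Fin n → Vec m} {lo hi : ℝ} (hlo : lo ≤ 0) (hhi : 0 ≤ hi)
    (h : ∀ j i, x j i ∈ Set.Icc lo hi) (i : Fin m) :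
    weightedComb f g p x i ∈ Set.Icc lo hi := by
  constructor
  · have h1 := hfg.weightedComb_mono hp (x := fun j i => min (x j i) 0) (y := x)
      (fun j i => min_le_left _ _) i
    have h2 := hfg.abs_weightedComb_le hp (x := fun j i => min (x j i) 0) (δ := -lo)
      (by linarith) (fun j i => by
        rw [abs_of_nonpos (min_le_right _ _)]
        have := le_min (h j i).1 hlo
        linarith) i
    have h3 := (abs_le.1 h2).1
    linarith
  · have h1 := hfg.weightedComb_mono hp (x := x) (y := fun j i => max (x j i) 0)
      (fun j i => le_max_left _ _) i
    have h2 := hfg.abs_weightedComb_le hp (x := fun j i => max (x j i) 0) (δ := hi)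
      hhi (fun j i => by
        rw [abs_of_nonneg (le_max_right _ _)]
        exact max_le (h j i).2 hhi) i
    have h3 := (abs_le.1 h2).2
    linarith

theorem weightedComb_congr (hfg : IsShortPair f g) {n : ℕ} {p : Fin n → ℝ} {x y : Fin n → Vec m}
    (h : ∀ j, p j ≠ 0 → x j = y j) : weightedComb f g p x = weightedComb f g p y := by
  rw [weightedComb, weightedComb]
  congr 2
  funext j
  by_cases hj : p j = 0
  · simp [hj, hfg.g_zero]
  · rw [h j hj]

theorem abs_prefixComb_le (hfg : IsShortPair f g) {n : ℕ} {p : Fin n → ℝ}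
    (hp : p ∈ stdSimplex ℝ (Fin n)) {x : Fin n → Vec m} {δ : ℝ} (hδ : 0 ≤ δ)
    (h : ∀ j i, |x j i| ≤ δ) (k : ℕ) (hk : k ≤ n) (i : Fin m) :
    |prefixComb f (fun j => g (p j) * x j) k i| ≤ δ := by
  have h1 := hfg.abs_weightedComb_le hp (x := fun j => if j.1 < k then x j else 0) hδ
    (fun j i => by
      split_ifs
      · exact h j i
      · simpa using hδ) i
  rw [hfg.prefixComb_eq_mask _ k hk]
  rw [weightedComb_eq_prefixComb] at h1
  convert h1 using 4 with j
  split_ifs <;> simp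

/-- Rounding up after each of `k` steps costs at most `k` units. -/
theorem roundedPrefix_bounds (hfg : IsShortPair f g) {ℓ : ℝ} (hℓ : 0 < ℓ) {n : ℕ}
    (p : Fin n → ℝ) (β : Fin n → Key m) (k : ℕ) (hk : k ≤ n) :
    prefixComb f (fun j => g (p j) * toVec ℓ (β j)) k ≤ toVec ℓ (roundedPrefix f g ℓ p β k) ∧
    ∀ i, toVec ℓ (roundedPrefix f g ℓ p β k) i ≤
      prefixComb f (fun j => g (p j) * toVec ℓ (β j)) k i + k * ℓ := by
  induction k with
  | zero => simp [roundedPrefix, prefixComb, toVec, Pi.le_def]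
  | succ k ih =>
    obtain ⟨h1, h2⟩ := ih (by omega)
    have hk' : k < n := hk
    rw [prefixComb_succ f _ k hk', roundedPrefix, dif_pos hk', roundedStep]
    constructor
    · intro i
      exact (hfg.mono _ _ _ _ h1 le_rfl i).trans (le_toVec_roundUp hℓ _ i)
    · intro i
      have h3 : ‖toVec ℓ (roundedPrefix f g ℓ p β k) -
          prefixComb f (fun j => g (p j) * toVec ℓ (β j)) k‖ ≤ k * ℓ := by
        refine (pi_norm_le_iff_of_nonneg (by positivity)).2 fun i => ?_
        have h4 := h1 i
        have h5 := h2 i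
        rw [Real.norm_eq_abs, Pi.sub_apply, abs_of_nonneg (by linarith)]
        linarith
      have h6 := apply_le_of_lipschitz (hfg.short_left (g (p ⟨k, hk'⟩) * toVec ℓ (β ⟨k, hk'⟩)))
        _ _ h3 i
      have h7 := toVec_roundUp_le hℓ (f (toVec ℓ (roundedPrefix f g ℓ p β k))
        (g (p ⟨k, hk'⟩) * toVec ℓ (β ⟨k, hk'⟩))) i
      push_cast
      linarith

theorem weightedComb_le_roundedPrefix (hfg : IsShortPair f g) {ℓ : ℝ} (hℓ : 0 < ℓ) {n : ℕ}
    (p : Fin n → ℝ) (β : Fin n → Key m) :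
    weightedComb f g p (fun j => toVec ℓ (β j)) ≤ toVec ℓ (roundedPrefix f g ℓ p β n) := by
  rw [weightedComb_eq_prefixComb]
  exact (hfg.roundedPrefix_bounds hℓ p β n le_rfl).1

theorem roundedPrefix_le_weightedComb (hfg : IsShortPair f g) {ℓ : ℝ} (hℓ : 0 < ℓ) {n : ℕ}
    (p : Fin n → ℝ) (β : Fin n → Key m) (i : Fin m) :
    toVec ℓ (roundedPrefix f g ℓ p β n) i ≤
      weightedComb f g p (fun j => toVec ℓ (β j)) i + n * ℓ := by
  rw [weightedComb_eq_prefixComb]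
  exact (hfg.roundedPrefix_bounds hℓ p β n le_rfl).2 i

end IsShortPair

/-! ### What the dynamic programs compute -/

section Update

variable (M : CaMDP m) (f : Vec m → Vec m → Vec m) (g : ℝ → Vec m) (ℓ : ℝ)
  (h : Fin M.H) (s : Fin M.S) (a : Fin M.A)

@[simp] theorem val_nextPartial (t : Fin M.S) (F b : Key m) :
    (nextPartial M f g ℓ h s a t F b).val = roundedStep f g ℓ (M.P h s a t) F b := rfl

/-- The lists `L t` contain all partial costs that are reachable from `0` in `t` steps with budgets
in `Bhat`. -/
structure IsLayers (Bhat : List (Key m)) (L : ℕ → List (Key m)) : Prop where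
  zero_mem : (0 : Key m) ∈ L 0
  step_mem : ∀ (t : Fin M.S), ∀ F ∈ L t.1, ∀ b ∈ Bhat,
    roundedStep f g ℓ (M.P h s a t) F b ∈ L (t.1 + 1)

/-- The states of the loop that collects, without repetitions, elements satisfying `src`. -/
def IsCollection (src : Key m → Prop) (st : List (Key m) × Table (Key m) Unit) : Prop :=
  st.1.Nodup ∧ (∀ x, st.2 x ≠ none ↔ x ∈ st.1) ∧ ∀ x ∈ st.1, src x

/-- The body of the inner loop of `forwardSets`. -/
noncomputable def collectStep (t : Fin M.S) (F b : Key m)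
    (st : List (Key m) × Table (Key m) Unit) : Timed (List (Key m) × Table (Key m) Unit) := do
  let F' ← nextPartial M f g ℓ h s a t F b
  let old ← Table.read m st.2 F'
  match old with
  | some _ => pure st
  | none => do
    let seen ← Table.write m st.2 F' ()
    Timed.op (F' :: st.1, seen)

theorem val_collectStep (t : Fin M.S) (F b : Key m) (src : Key m → Prop)
    (hsrc : src (roundedStep f g ℓ (M.P h s a t) F b))
    (st : List (Key m) × Table (Key m) Unit) (hst : IsCollection src st) :
    IsCollection src (collectStep M f g ℓ h s a t F b st).val ∧
      st.1 ⊆ (collectStep M f g ℓ h s a t F b st).val.1 ∧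
      roundedStep f g ℓ (M.P h s a t) F b ∈ (collectStep M f g ℓ h s a t F b st).val.1 := by
  obtain ⟨h1, h2, h3⟩ := hst
  simp only [collectStep, Timed.val_bind, val_nextPartial, Table.val_read]
  generalize roundedStep f g ℓ (M.P h s a t) F b = F' at hsrc ⊢
  cases hF : st.2 F' with
  | some u =>
    have hmem : F' ∈ st.1 := (h2 F').1 (by simp [hF])
    exact ⟨⟨h1, h2, h3⟩, fun x hx => hx, hmem⟩
  | none =>
    have hmem : F' ∉ st.1 := fun hc => (h2 F').2 hc hF
    refine ⟨⟨List.nodup_cons.2 ⟨hmem, h1⟩, fun x => ?_, ?_⟩, fun x hx => ?_, ?_⟩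
    · by_cases hx : x = F'
      · subst hx
        simp
      · simpa [hx] using h2 x
    · intro x hx
      rcases List.mem_cons.1 hx with rfl | hx
      · exact hsrc
      · exact h3 x hx
    · exact List.mem_cons_of_mem _ hx
    · exact List.mem_cons_self

theorem val_collect_loop (t : Fin M.S) (L Bhat : List (Key m)) :
    let res := (Timed.loop L (fun F => Timed.loop Bhat (collectStep M f g ℓ h s a t F))
      ([], Table.empty)).val
    res.1.Nodup ∧
      (∀ F ∈ L, ∀ b ∈ Bhat, roundedStep f g ℓ (M.P h s a t) F b ∈ res.1) ∧
      ∀ F' ∈ res.1, ∃ F ∈ L, ∃ b ∈ Bhat, F' = roundedStep f g ℓ (M.P h s a t) F b := by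
  intro res
  let src : Key m → Prop := fun F' => ∃ F ∈ L, ∃ b ∈ Bhat,
    F' = roundedStep f g ℓ (M.P h s a t) F b
  have inner : ∀ F ∈ L, ∀ st, IsCollection src st →
      IsCollection src (Timed.loop Bhat (collectStep M f g ℓ h s a t F) st).val ∧
      st.1 ⊆ (Timed.loop Bhat (collectStep M f g ℓ h s a t F) st).val.1 ∧
      ∀ b ∈ Bhat, roundedStep f g ℓ (M.P h s a t) F b ∈
        (Timed.loop Bhat (collectStep M f g ℓ h s a t F) st).val.1 := by
    intro F hF st hst
    refine Timed.loop_invariant Bhat _ st (fun pre st' => IsCollection src st' ∧ st.1 ⊆ st'.1 ∧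
      ∀ b ∈ pre, roundedStep f g ℓ (M.P h s a t) F b ∈ st'.1) ⟨hst, fun x hx => hx, by simp⟩ ?_
    rintro pre b suf st' hl ⟨i1, i2, i3⟩
    obtain ⟨j1, j2, j3⟩ := val_collectStep M f g ℓ h s a t F b src
      ⟨F, hF, b, by simp [hl], rfl⟩ st' i1
    refine ⟨j1, List.Subset.trans i2 j2, fun b' hb' => ?_⟩
    rcases List.mem_append.1 hb' with hb' | hb'
    · exact j2 (i3 b' hb')
    · rw [List.mem_singleton.1 hb']
      exact j3
  have key : IsCollection src res ∧
      ∀ F ∈ L, ∀ b ∈ Bhat, roundedStep f g ℓ (M.P h s a t) F b ∈ res.1 := by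
    refine Timed.loop_invariant L _ _ (fun pre st' => IsCollection src st' ∧
      ∀ F ∈ pre, ∀ b ∈ Bhat, roundedStep f g ℓ (M.P h s a t) F b ∈ st'.1) ⟨⟨?_, ?_, ?_⟩, ?_⟩ ?_
    · simp
    · simp [Table.empty]
    · simp
    · simp
    rintro pre F suf st' hl ⟨i1, i2⟩
    obtain ⟨j1, j2, j3⟩ := inner F (by simp [hl]) st' i1
    refine ⟨j1, fun F' hF' => ?_⟩
    rcases List.mem_append.1 hF' with hF' | hF'
    · exact fun b hb => j2 (i2 F' hF' b hb)
    · rw [List.mem_singleton.1 hF']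
      exact j3
  exact ⟨key.1.1, key.2, key.1.2.2⟩

/-- The layers in a (partially filled) table. -/
def layer (layers : Table ℕ (List (Key m))) (t : ℕ) : List (Key m) := (layers t).getD []

theorem pre_eq_of_finRange {n : ℕ} {pre suf : List (Fin n)} {t : Fin n}
    (hl : List.finRange n = pre ++ t :: suf) : pre.length = t.1 ∧ ∀ j, j ∈ pre ↔ j.1 < t.1 := by
  have h1 : pre.length < (List.finRange n).length := by rw [hl]; simp
  have h2 : (List.finRange n)[pre.length]'h1 = t := by simp [hl]
  have h3 : pre.length = t.1 := by simpa [Fin.ext_iff] using h2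
  refine ⟨h3, fun j => ⟨fun hj => ?_, fun hj => ?_⟩⟩
  · have h4 := List.pairwise_lt_finRange n
    rw [hl, List.pairwise_append] at h4
    exact h4.2.2 j hj t (by simp)
  · have h5 : j ∈ pre ++ t :: suf := hl ▸ List.mem_finRange j
    have h4 := List.pairwise_lt_finRange n
    rw [hl, List.pairwise_append] at h4
    rcases List.mem_append.1 h5 with h5 | h5
    · exact h5
    · rcases List.mem_cons.1 h5 with rfl | h5
      · omega
      · have h6 := (List.pairwise_cons.1 h4.2.1).1 j h5
        rw [Fin.lt_def] at h6
        omega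

theorem isLayers_forwardSets (Bhat : List (Key m)) :
    IsLayers M f g ℓ h s a Bhat (layer (forwardSets M f g ℓ h s a Bhat).val) := by
  have key := Timed.loop_invariant (List.finRange M.S) (fun t layers => do
      let L ← Table.read 1 layers t.1
      let res ← Timed.loop (L.getD []) (fun F => Timed.loop Bhat (collectStep M f g ℓ h s a t F))
        ([], Table.empty)
      Table.write 1 layers (t.1 + 1) res.1)
    (Table.write 1 Table.empty 0 [(0 : Key m)]).val
    (fun pre layers => layer layers 0 = [0] ∧ ∀ t : Fin M.S, t ∈ pre →
      ∀ F ∈ layer layers t.1, ∀ b ∈ Bhat,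
        roundedStep f g ℓ (M.P h s a t) F b ∈ layer layers (t.1 + 1)) ?_ ?_
  · exact ⟨key.1 ▸ List.mem_singleton.2 rfl, fun t => key.2 t (List.mem_finRange t)⟩
  · simp [layer]
  · rintro pre t suf layers hl ⟨h0, h1⟩
    have hpre := (pre_eq_of_finRange hl).2
    simp only [Timed.val_bind, Table.val_read, Table.val_write]
    have hres := (val_collect_loop M f g ℓ h s a t (layer layers t.1) Bhat).2.1
    have hne : ∀ j, j ≠ t.1 + 1 → ∀ x : List (Key m),
        layer (Function.update layers (t.1 + 1) (some x)) j = layer layers j := by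
      intro j hj x
      simp [layer, hj]
    have heq : ∀ x : List (Key m),
        layer (Function.update layers (t.1 + 1) (some x)) (t.1 + 1) = x := by
      intro x
      simp [layer]
    refine ⟨by rw [hne _ (by omega)]; exact h0, fun t' ht' => ?_⟩
    rcases List.mem_append.1 ht' with ht' | ht'
    · have hlt := (hpre t').1 ht'
      rw [hne _ (by omega), hne _ (by omega)]
      exact h1 t' ht'
    · rw [List.mem_singleton.1 ht', heq, hne _ (by omega)]
      exact hres

/-- The final values of the inner dynamic program: `0` if the rounded cost fits into the budget
`b`, up to the slack `ℓ (S + 1)`, and `⊥` otherwise. -/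
noncomputable def dpBase (b F : Key m) : EReal :=
  open Classical in
  if ∀ i, M.c h s a i + toVec ℓ F i ≤ toVec ℓ b i + ℓ * ((M.S : ℝ) + 1) then 0 else ⊥

/-- The value that an entry of the inner dynamic program holds. -/
noncomputable def dpVal (T : DPTable m) (k : ℕ × Key m) : EReal := ((T k).getD (⊥, 0)).1

/-- The candidate value of the budget `b'` at the entry `(t, F)` of the inner dynamic program. -/
noncomputable def dpCand (Vf : Fin M.S → Key m → EReal) (T : DPTable m) (t : Fin M.S)
    (F b' : Key m) : EReal :=
  (M.P h s a t : EReal) * Vf t b' +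
    dpVal T (t.1 + 1, roundedStep f g ℓ (M.P h s a t) F b')

/-- `T` solves the inner dynamic program on the layers `L`. -/
structure IsDPSolution (b : Key m) (Bhat : List (Key m)) (Vf : Fin M.S → Key m → EReal)
    (L : ℕ → List (Key m)) (T : DPTable m) : Prop where
  base : ∀ F ∈ L M.S, dpVal T (M.S, F) = dpBase M ℓ h s a b F
  step : ∀ (t : Fin M.S), ∀ F ∈ L t.1, ∃ b' ∈ Bhat,
    T (t.1, F) = some (dpCand M f g ℓ h s a Vf T t F b', b') ∧
    ∀ b'' ∈ Bhat, dpCand M f g ℓ h s a Vf T t F b'' ≤ dpCand M f g ℓ h s a Vf T t F b'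

theorem dpCand_congr (Vf : Fin M.S → Key m → EReal) (T T' : DPTable m) (t : Fin M.S)
    (hT : ∀ F, T (t.1 + 1, F) = T' (t.1 + 1, F)) (F b' : Key m) :
    dpCand M f g ℓ h s a Vf T t F b' = dpCand M f g ℓ h s a Vf T' t F b' := by
  rw [dpCand, dpCand, dpVal, dpVal, hT]

theorem isDPSolution_approxDP (b : Key m) (Bhat : List (Key m)) (hB : Bhat ≠ [])
    (V : ValueTable M) (layers : Table ℕ (List (Key m))) :
    IsDPSolution M f g ℓ h s a b Bhat (fun t b' => (V (h.1 + 1, t, b')).getD ⊥) (layer layers)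
      (approxDP M f g ℓ h s a b Bhat V layers).val := by
  set Vf : Fin M.S → Key m → EReal := fun t b' => (V (h.1 + 1, t, b')).getD ⊥ with hVf
  simp only [approxDP, Timed.val_bind, Timed.val_op, Timed.val_vec, Table.val_read]
  set T₀ : DPTable m := (Timed.loop ((layers M.S).getD []) _ Table.empty).val with hT₀
  have hbase : ∀ F ∈ layer layers M.S, dpVal T₀ (M.S, F) = dpBase M ℓ h s a b F := by
    refine Timed.loop_invariant (layer layers M.S) _ Table.empty (fun pre T => ∀ F ∈ pre,
      dpVal T (M.S, F) = dpBase M ℓ h s a b F) (by simp) ?_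
    rintro pre F suf T hl hI F' hF'
    simp only [Timed.val_bind, Timed.val_vec, Timed.val_charge, Table.val_write]
    by_cases hFF : F' = F
    · subst hFF
      simp only [dpVal, dpBase, toVec, Function.update_self, Option.getD_some]
      exact if_congr decide_eq_true_iff rfl rfl
    · have : F' ∈ pre := by simpa [hFF] using hF'
      rw [← hI F' this]
      simp [dpVal, hFF]
  have key := Timed.loop_invariant (List.finRange M.S).reverse (fun t T => do
    let L ← Table.read 1 layers t.1
    Timed.loop (L.getD []) (fun F (T : DPTable m) => do
      let best ← Timed.loop Bhat (fun b' best => do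
        let v ← Table.read (m + 2) V (h.1 + 1, t, b')
        let p ← Timed.op (M.P h s a t)
        let pv ← Timed.op ((p : EReal) * v.getD ⊥)
        let F' ← nextPartial M f g ℓ h s a t F b'
        let rest ← Table.read (m + 1) T (t.1 + 1, F')
        let tot ← Timed.op (pv + (rest.getD (⊥, 0)).1)
        keepBetter best (tot, b')) none
      Table.write (m + 1) T (t.1, F) (best.getD (⊥, 0))) T) T₀
    (fun pre T => (∀ F ∈ layer layers M.S, dpVal T (M.S, F) = dpBase M ℓ h s a b F) ∧
      ∀ t : Fin M.S, t ∈ pre → ∀ F ∈ layer layers t.1, ∃ b' ∈ Bhat,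
        T (t.1, F) = some (dpCand M f g ℓ h s a Vf T t F b', b') ∧
        ∀ b'' ∈ Bhat, dpCand M f g ℓ h s a Vf T t F b'' ≤ dpCand M f g ℓ h s a Vf T t F b')
    ⟨hbase, by simp⟩ ?_
  · exact ⟨key.1, fun t => key.2 t (by simp)⟩
  · rintro pre t suf T hl ⟨i1, i2⟩
    have hgt : ∀ t' ∈ pre, t < t' := by
      have h4 := List.pairwise_lt_finRange M.S
      rw [← List.pairwise_reverse, hl, List.pairwise_append] at h4
      exact fun t' ht' => h4.2.2 t' ht' t (by simp)
    simp only [Timed.val_bind, Table.val_read]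
    -- the loop over the layer writes only to the row `t`
    have row := Timed.loop_invariant ((layers t.1).getD []) (fun F (T : DPTable m) => do
      let best ← Timed.loop Bhat (fun b' best => do
        let v ← Table.read (m + 2) V (h.1 + 1, t, b')
        let p ← Timed.op (M.P h s a t)
        let pv ← Timed.op ((p : EReal) * v.getD ⊥)
        let F' ← nextPartial M f g ℓ h s a t F b'
        let rest ← Table.read (m + 1) T (t.1 + 1, F')
        let tot ← Timed.op (pv + (rest.getD (⊥, 0)).1)
        keepBetter best (tot, b')) none
      Table.write (m + 1) T (t.1, F) (best.getD (⊥, 0))) T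
      (fun pre T' => (∀ k F, k ≠ t.1 → T' (k, F) = T (k, F)) ∧ ∀ F ∈ pre, ∃ b' ∈ Bhat,
        T' (t.1, F) = some (dpCand M f g ℓ h s a Vf T t F b', b') ∧
        ∀ b'' ∈ Bhat, dpCand M f g ℓ h s a Vf T t F b'' ≤ dpCand M f g ℓ h s a Vf T t F b')
      ⟨fun _ _ _ => rfl, by simp⟩ ?_
    · obtain ⟨r1, r2⟩ := row
      refine ⟨fun F hF => ?_, fun t' ht' F hF => ?_⟩
      · rw [dpVal, r1 _ _ (by omega)]
        exact i1 F hF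
      · have hne : t'.1 + 1 ≠ t.1 := by
          rcases List.mem_append.1 ht' with ht' | ht'
          · have := Fin.lt_def.1 (hgt t' ht')
            omega
          · rw [List.mem_singleton.1 ht']
            omega
        simp only [dpCand_congr M f g ℓ h s a Vf _ T t' (fun F => r1 _ F hne)]
        rcases List.mem_append.1 ht' with ht' | ht'
        · have := Fin.lt_def.1 (hgt t' ht')
          rw [r1 _ _ (by omega)]
          exact i2 t' ht' F hF
        · rw [List.mem_singleton.1 ht'] at hF ⊢
          exact r2 F hF
    · rintro pre' F suf' T' hl' ⟨j1, j2⟩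
      obtain ⟨b', hb', -, hval, hmax⟩ := loop_keepBetter Bhat (fun _ => True)
        (fun b' => (dpCand M f g ℓ h s a Vf T t F b', b')) (fun b' best => do
        let v ← Table.read (m + 2) V (h.1 + 1, t, b')
        let p ← Timed.op (M.P h s a t)
        let pv ← Timed.op ((p : EReal) * v.getD ⊥)
        let F' ← nextPartial M f g ℓ h s a t F b'
        let rest ← Table.read (m + 1) T' (t.1 + 1, F')
        let tot ← Timed.op (pv + (rest.getD (⊥, 0)).1)
        keepBetter best (tot, b')) (fun b' st _ => by
          simp only [Timed.val_bind, Timed.val_op, Table.val_read, val_nextPartial]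
          rw [j1 _ _ (by omega)]
          rfl) (fun _ _ hh => absurd trivial hh)
        (by
          obtain ⟨b', hb'⟩ := List.exists_mem_of_ne_nil _ hB
          exact ⟨b', hb', trivial⟩)
      simp only [Timed.val_bind] at hval ⊢
      rw [hval]
      simp only [Table.val_write, Option.getD_some]
      refine ⟨fun k F' hk => ?_, fun F' hF' => ?_⟩
      · rw [← j1 k F' hk]
        simp [hk]
      · by_cases hFF : F' = F
        · subst hFF
          exact ⟨b', hb', by simp, fun b'' hb'' => hmax b'' hb'' trivial⟩
        · have : F' ∈ pre' := by simpa [hFF] using hF'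
          obtain ⟨c, hc, e1, e2⟩ := j2 F' this
          exact ⟨c, hc, by simpa [hFF] using e1, e2⟩

end Update

section Update

variable (M : CaMDP m) (f : Vec m → Vec m → Vec m) (g : ℝ → Vec m) (ℓ : ℝ)
  (h : Fin M.H) (s : Fin M.S) (a : Fin M.A)

/-- The rounded total of the future costs if the budgets `β` are chosen for the next states. -/
noncomputable def roundedCost (β : Fin M.S → Key m) : Key m :=
  roundedPrefix f g ℓ (M.P h s a) β M.S

/-- The value of the action `a` with the budgets `β` for the next states: it is `⊥` if the rounded
cost does not fit into the budget `b`. -/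
noncomputable def actionValue (b : Key m) (Vf : Fin M.S → Key m → EReal)
    (β : Fin M.S → Key m) : EReal :=
  (M.r h s a : EReal) + ((∑ t, (M.P h s a t : EReal) * Vf t (β t)) +
    dpBase M ℓ h s a b (roundedCost M f g ℓ h s a β))

/-- The contribution to the value of the next states from the `k`-th on. -/
noncomputable def tailSum (Vf : Fin M.S → Key m → EReal) (β : Fin M.S → Key m) (k : ℕ) : EReal :=
  (((List.finRange M.S).drop k).map fun t => (M.P h s a t : EReal) * Vf t (β t)).sum

theorem tailSum_zero (Vf : Fin M.S → Key m → EReal) (β : Fin M.S → Key m) :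
    tailSum M h s a Vf β 0 = ∑ t, (M.P h s a t : EReal) * Vf t (β t) := by
  rw [tailSum, List.drop_zero, Fin.sum_univ_def]

theorem tailSum_last (Vf : Fin M.S → Key m → EReal) (β : Fin M.S → Key m) :
    tailSum M h s a Vf β M.S = 0 := by
  rw [tailSum, List.drop_of_length_le (by simp)]
  rfl

theorem tailSum_eq (Vf : Fin M.S → Key m → EReal) (β : Fin M.S → Key m) (t : Fin M.S) :
    tailSum M h s a Vf β t.1 =
      (M.P h s a t : EReal) * Vf t (β t) + tailSum M h s a Vf β (t.1 + 1) := by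
  have ht : t.1 < (List.finRange M.S).length := by simp
  rw [tailSum, List.drop_eq_getElem_cons ht, List.map_cons, List.sum_cons, tailSum]
  simp

variable {M f g ℓ h s a}

theorem roundedPrefix_mem {Bhat : List (Key m)} {L : ℕ → List (Key m)}
    (hL : IsLayers M f g ℓ h s a Bhat L) {β : Fin M.S → Key m} (hβ : ∀ t, β t ∈ Bhat) (k : ℕ)
    (hk : k ≤ M.S) : roundedPrefix f g ℓ (M.P h s a) β k ∈ L k := by
  induction k with
  | zero => exact hL.zero_mem
  | succ k ih =>
    rw [roundedPrefix, dif_pos (show k < M.S from hk)]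
    exact hL.step_mem ⟨k, hk⟩ _ (ih (by omega)) _ (hβ _)

theorem IsDPSolution.dpVal_ge {b : Key m} {Bhat : List (Key m)} {Vf : Fin M.S → Key m → EReal}
    {L : ℕ → List (Key m)} {T : DPTable m} (hL : IsLayers M f g ℓ h s a Bhat L)
    (hT : IsDPSolution M f g ℓ h s a b Bhat Vf L T) {β : Fin M.S → Key m}
    (hβ : ∀ t, β t ∈ Bhat) :
    (∑ t, (M.P h s a t : EReal) * Vf t (β t)) +
      dpBase M ℓ h s a b (roundedCost M f g ℓ h s a β) ≤ dpVal T (0, 0) := by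
  have key : ∀ d k, k + d = M.S → tailSum M h s a Vf β k +
      dpBase M ℓ h s a b (roundedCost M f g ℓ h s a β) ≤
        dpVal T (k, roundedPrefix f g ℓ (M.P h s a) β k) := by
    intro d
    induction d with
    | zero =>
      intro k hk
      obtain rfl : k = M.S := by omega
      rw [tailSum_last, zero_add, hT.base _ (roundedPrefix_mem hL hβ _ le_rfl), roundedCost]
    | succ d ih =>
      intro k hk
      have hk' : k < M.S := by omega
      obtain ⟨b', hb', h1, h2⟩ := hT.step ⟨k, hk'⟩ _ (roundedPrefix_mem hL hβ k hk'.le)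
      have h3 := h2 (β ⟨k, hk'⟩) (hβ _)
      have h4 := ih (k + 1) (by omega)
      rw [roundedPrefix, dif_pos hk'] at h4
      simp only at h1
      rw [dpVal, h1, Option.getD_some]
      refine le_trans ?_ h3
      rw [tailSum_eq M h s a Vf β ⟨k, hk'⟩, add_assoc, dpCand]
      exact add_le_add le_rfl h4
  have h0 := key M.S 0 (by omega)
  rwa [tailSum_zero] at h0

/-- The budget stored at the entry `(t, F)` of the inner dynamic program. -/
noncomputable def storedBudget (T : DPTable m) (t : ℕ) (F : Key m) : Key m :=
  ((T (t, F)).getD (⊥, 0)).2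

/-- The partial costs met when reading the maximising budgets off the table. -/
noncomputable def greedyCost (f : Vec m → Vec m → Vec m) (g : ℝ → Vec m) (ℓ : ℝ) {n : ℕ}
    (p : Fin n → ℝ) (T : DPTable m) : ℕ → Key m
  | 0 => 0
  | k + 1 =>
    if h : k < n then roundedStep f g ℓ (p ⟨k, h⟩) (greedyCost f g ℓ p T k)
      (storedBudget T k (greedyCost f g ℓ p T k))
    else greedyCost f g ℓ p T k

/-- The maximising budgets read off the table. -/
noncomputable def greedyBudget (f : Vec m → Vec m → Vec m) (g : ℝ → Vec m) (ℓ : ℝ) {n : ℕ}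
    (p : Fin n → ℝ) (T : DPTable m) (t : Fin n) : Key m :=
  storedBudget T t.1 (greedyCost f g ℓ p T t.1)

theorem roundedPrefix_greedyBudget {n : ℕ} (p : Fin n → ℝ) (T : DPTable m) (k : ℕ) :
    roundedPrefix f g ℓ p (greedyBudget f g ℓ p T) k = greedyCost f g ℓ p T k := by
  induction k with
  | zero => rfl
  | succ k ih => rw [roundedPrefix, greedyCost, ih]; rfl

theorem greedyCost_mem {b : Key m} {Bhat : List (Key m)} {Vf : Fin M.S → Key m → EReal}
    {L : ℕ → List (Key m)} {T : DPTable m} (hL : IsLayers M f g ℓ h s a Bhat L)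
    (hT : IsDPSolution M f g ℓ h s a b Bhat Vf L T) (k : ℕ) (hk : k ≤ M.S) :
    greedyCost f g ℓ (M.P h s a) T k ∈ L k := by
  induction k with
  | zero => exact hL.zero_mem
  | succ k ih =>
    rw [greedyCost, dif_pos (show k < M.S from hk)]
    refine hL.step_mem ⟨k, hk⟩ _ (ih (by omega)) _ ?_
    obtain ⟨b', hb', h1, -⟩ := hT.step ⟨k, hk⟩ _ (ih (by omega))
    simp only at h1
    rw [storedBudget, h1]
    exact hb'

theorem greedyBudget_mem {b : Key m} {Bhat : List (Key m)} {Vf : Fin M.S → Key m → EReal}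
    {L : ℕ → List (Key m)} {T : DPTable m} (hL : IsLayers M f g ℓ h s a Bhat L)
    (hT : IsDPSolution M f g ℓ h s a b Bhat Vf L T) (t : Fin M.S) :
    greedyBudget f g ℓ (M.P h s a) T t ∈ Bhat := by
  obtain ⟨b', hb', h1, -⟩ := hT.step t _ (greedyCost_mem hL hT t.1 t.2.le)
  rw [greedyBudget, storedBudget, h1]
  exact hb'

theorem IsDPSolution.dpVal_eq {b : Key m} {Bhat : List (Key m)} {Vf : Fin M.S → Key m → EReal}
    {L : ℕ → List (Key m)} {T : DPTable m} (hL : IsLayers M f g ℓ h s a Bhat L)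
    (hT : IsDPSolution M f g ℓ h s a b Bhat Vf L T) :
    dpVal T (0, 0) =
      (∑ t, (M.P h s a t : EReal) * Vf t (greedyBudget f g ℓ (M.P h s a) T t)) +
      dpBase M ℓ h s a b (roundedCost M f g ℓ h s a (greedyBudget f g ℓ (M.P h s a) T)) := by
  set β := greedyBudget f g ℓ (M.P h s a) T with hβ
  have key : ∀ d k, k + d = M.S →
      dpVal T (k, greedyCost f g ℓ (M.P h s a) T k) = tailSum M h s a Vf β k +
        dpBase M ℓ h s a b (roundedCost M f g ℓ h s a β) := by
    intro d
    induction d with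
    | zero =>
      intro k hk
      obtain rfl : k = M.S := by omega
      rw [tailSum_last, zero_add, hT.base _ (greedyCost_mem hL hT _ le_rfl), roundedCost,
        roundedPrefix_greedyBudget]
    | succ d ih =>
      intro k hk
      have hk' : k < M.S := by omega
      obtain ⟨b', hb', h1, -⟩ := hT.step ⟨k, hk'⟩ _ (greedyCost_mem hL hT k hk'.le)
      have h4 := ih (k + 1) (by omega)
      simp only at h1
      have hb : β ⟨k, hk'⟩ = b' := by
        rw [hβ, greedyBudget, storedBudget, h1, Option.getD_some]
      rw [greedyCost, dif_pos hk', storedBudget, h1, Option.getD_some] at h4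
      rw [dpVal, h1, Option.getD_some, dpCand, tailSum_eq M h s a Vf β ⟨k, hk'⟩, add_assoc, hb]
      exact congrArg ((M.P h s a ⟨k, hk'⟩ : EReal) * Vf ⟨k, hk'⟩ b' + ·) h4
  have h0 := key M.S 0 (by omega)
  rwa [tailSum_zero] at h0

theorem val_recoverBudgets (T : DPTable m) (t : Fin M.S) :
    (recoverBudgets M f g ℓ h s a T).val t =
      some (greedyBudget f g ℓ (M.P h s a) T t) := by
  have key := Timed.loop_invariant (List.finRange M.S)
    (fun t (st : Key m × Table (Fin M.S) (Key m)) => do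
      let e ← Table.read (m + 1) T (t.1, st.1)
      let F' ← nextPartial M f g ℓ h s a t st.1 (e.getD (⊥, 0)).2
      let w ← Table.write 1 st.2 t (e.getD (⊥, 0)).2
      pure (F', w)) (0, Table.empty)
    (fun pre st => st.1 = greedyCost f g ℓ (M.P h s a) T pre.length ∧
      ∀ t ∈ pre, st.2 t = some (greedyBudget f g ℓ (M.P h s a) T t)) ⟨rfl, by simp⟩ ?_
  · exact key.2 t (List.mem_finRange t)
  · rintro pre t suf st hl ⟨i1, i2⟩
    have hlen := (pre_eq_of_finRange hl).1
    simp only [Timed.val_bind, Table.val_read, val_nextPartial, Table.val_write, Timed.val_pure]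
    rw [hlen] at i1
    refine ⟨?_, fun t' ht' => ?_⟩
    · rw [List.length_append, List.length_singleton, hlen, greedyCost, dif_pos t.2, i1]
      rfl
    · by_cases htt : t' = t
      · subst htt
        rw [Function.update_self, i1]
        rfl
      · rw [Function.update_of_ne htt]
        exact i2 t' (by simpa [htt] using ht')

variable (M f g ℓ h s) in
/-- The result `(v, a, w)` of an optimal update at the budget `b`: the action `a` and the budgets
`w`, chosen from `Bhat`, attain the largest value `v`. -/
structure IsBestUpdate (b : Key m) (Bhat : List (Key m)) (Vf : Fin M.S → Key m → EReal)
    (v : EReal) (a : Fin M.A) (w : Table (Fin M.S) (Key m)) : Prop where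
  mem : a ∈ M.act h s
  exists_budgets : ∃ β : Fin M.S → Key m, (∀ t, w t = some (β t)) ∧ (∀ t, β t ∈ Bhat) ∧
    v = actionValue M f g ℓ h s a b Vf β
  le : ∀ a' ∈ M.act h s, ∀ β : Fin M.S → Key m, (∀ t, β t ∈ Bhat) →
    actionValue M f g ℓ h s a' b Vf β ≤ v

variable (M f g ℓ h s) in
theorem val_approxUpdate (b : Key m) {Bhat : List (Key m)} (hB : Bhat ≠ []) (V : ValueTable M) :
    ∃ v a w, (approxUpdate M f g ℓ h s b Bhat V).val = some (v, a, w) ∧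
      IsBestUpdate M f g ℓ h s b Bhat (fun t b' => (V (h.1 + 1, t, b')).getD ⊥) v a w := by
  set Vf : Fin M.S → Key m → EReal := fun t b' => (V (h.1 + 1, t, b')).getD ⊥
  let lay : Fin M.A → Table ℕ (List (Key m)) := fun a => (forwardSets M f g ℓ h s a Bhat).val
  let T : Fin M.A → DPTable m := fun a => (approxDP M f g ℓ h s a b Bhat V (lay a)).val
  have hL : ∀ a, IsLayers M f g ℓ h s a Bhat (layer (lay a)) :=
    fun a => isLayers_forwardSets M f g ℓ h s a Bhat
  have hT : ∀ a, IsDPSolution M f g ℓ h s a b Bhat Vf (layer (lay a)) (T a) :=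
    fun a => isDPSolution_approxDP M f g ℓ h s a b Bhat hB V (lay a)
  obtain ⟨a, -, ha, hval, hmax⟩ := loop_keepBetter (List.finRange M.A) (fun a => a ∈ M.act h s)
    (fun a => ((M.r h s a : EReal) + dpVal (T a) (0, 0), a, T a))
    (fun a (best : Option (EReal × Fin M.A × DPTable m)) => do
      let ok ← Timed.op (decide (a ∈ M.act h s))
      if ok then do
        let layers ← forwardSets M f g ℓ h s a Bhat
        let T ← approxDP M f g ℓ h s a b Bhat V layers
        let x ← Table.read (m + 1) T (0, 0)
        let tot ← Timed.op ((M.r h s a : EReal) + (x.getD (⊥, 0)).1)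
        keepBetter best (tot, a, T)
      else pure best)
    (fun a st ha => by simp [ha, T, lay, dpVal])
    (fun a st ha => by simp [ha])
    (by
      obtain ⟨a, ha⟩ := M.act_nonempty h s
      exact ⟨a, List.mem_finRange a, ha⟩)
  refine ⟨(M.r h s a : EReal) + dpVal (T a) (0, 0), a,
    (recoverBudgets M f g ℓ h s a (T a)).val, ?_, ha, ?_, ?_⟩
  · rw [approxUpdate, Timed.val_bind, hval]
    rfl
  · refine ⟨greedyBudget f g ℓ (M.P h s a) (T a), val_recoverBudgets _,
      greedyBudget_mem (hL a) (hT a), ?_⟩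
    rw [(hT a).dpVal_eq (hL a), actionValue]
  · intro a' ha' β hβ
    refine le_trans ?_ (hmax a' (List.mem_finRange a') ha')
    exact add_le_add le_rfl ((hT a').dpVal_ge (hL a') hβ)

end Update

/-- The budgets for which step `h` is solved. -/
def budgetsAt (Bhat : List (Key m)) (b₀ : Key m) (h : ℕ) : List (Key m) :=
  if h = 0 then b₀ :: Bhat else Bhat

/-- What the backward induction computes: the values `V` and the choices `Q`. -/
structure IsBackwardSolution (M : CaMDP m) (f : Vec m → Vec m → Vec m) (g : ℝ → Vec m) (ℓ : ℝ)
    (Bhat : List (Key m)) (b₀ : Key m) (V : ℕ → Fin M.S → Key m → EReal) (Q : AugPolicy M) :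
    Prop where
  last : ∀ s, ∀ b ∈ Bhat, V M.H s b = if ∀ i, 0 ≤ b i then 0 else ⊥
  step : ∀ (h : Fin M.H) (s : Fin M.S), ∀ b ∈ budgetsAt Bhat b₀ h.1, ∃ a w,
    Q (h.1, s, b) = some (a, w) ∧
      IsBestUpdate M f g ℓ h s b Bhat (V (h.1 + 1)) (V h.1 s b) a w

/-- The values in a table. -/
noncomputable def tableVal {M : CaMDP m} (V : ValueTable M) (h : ℕ) (s : Fin M.S) (b : Key m) :
    EReal :=
  (V (h, s, b)).getD ⊥

section Backward

variable (M : CaMDP m) (f : Vec m → Vec m → Vec m) (g : ℝ → Vec m) (ℓ : ℝ)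

/-- The body of the main loop, at step `h`, for one augmented state. -/
noncomputable def updateStep (Bhat : List (Key m)) (h : Fin M.H) (s : Fin M.S) (b : Key m)
    (st : ValueTable M × AugPolicy M) : Timed (ValueTable M × AugPolicy M) := do
  let u ← approxUpdate M f g ℓ h s b Bhat st.1
  match u with
  | none => pure st
  | some (v, a, w) => do
    let V ← Table.write (m + 2) st.1 (h.1, s, b) v
    let Q ← Table.write (m + 2) st.2 (h.1, s, b) (a, w)
    pure (V, Q)

variable {M f g ℓ}

/-- The entry `(h, s, b)` has been filled correctly. -/
def IsSolvedAt (M : CaMDP m) (f : Vec m → Vec m → Vec m) (g : ℝ → Vec m) (ℓ : ℝ)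
    (Bhat : List (Key m)) (h : Fin M.H) (s : Fin M.S) (b : Key m)
    (st : ValueTable M × AugPolicy M) : Prop :=
  ∃ a w, st.2 (h.1, s, b) = some (a, w) ∧
    IsBestUpdate M f g ℓ h s b Bhat (tableVal st.1 (h.1 + 1)) (tableVal st.1 h.1 s b) a w

theorem IsSolvedAt.congr {Bhat : List (Key m)} {h : Fin M.H} {s : Fin M.S} {b : Key m}
    {st st' : ValueTable M × AugPolicy M} (hst : IsSolvedAt M f g ℓ Bhat h s b st)
    (h1 : st'.1 (h.1, s, b) = st.1 (h.1, s, b)) (h2 : st'.2 (h.1, s, b) = st.2 (h.1, s, b))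
    (h3 : ∀ s' b', st'.1 (h.1 + 1, s', b') = st.1 (h.1 + 1, s', b')) :
    IsSolvedAt M f g ℓ Bhat h s b st' := by
  obtain ⟨a, w, e1, e2⟩ := hst
  refine ⟨a, w, h2.trans e1, ?_⟩
  have : tableVal st'.1 (h.1 + 1) = tableVal st.1 (h.1 + 1) := by
    funext s' b'
    rw [tableVal, h3]
    rfl
  rw [this, tableVal, h1]
  exact e2

theorem val_updateStep {Bhat : List (Key m)} (hB : Bhat ≠ []) (h : Fin M.H) (s : Fin M.S)
    (b : Key m) (st : ValueTable M × AugPolicy M) :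
    let st' := (updateStep M f g ℓ Bhat h s b st).val
    IsSolvedAt M f g ℓ Bhat h s b st' ∧
      ∀ k ≠ (h.1, s, b), st'.1 k = st.1 k ∧ st'.2 k = st.2 k := by
  obtain ⟨v, a, w, h1, h2⟩ := val_approxUpdate M f g ℓ h s b hB st.1
  have h3 : (updateStep M f g ℓ Bhat h s b st).val =
      (Function.update st.1 (h.1, s, b) (some v),
        Function.update st.2 (h.1, s, b) (some (a, w))) := by
    rw [updateStep, Timed.val_bind, h1]
    rfl
  rw [h3]
  refine ⟨⟨a, w, by simp, ?_⟩, fun k hk => by simp [hk]⟩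
  have : tableVal (Function.update st.1 (h.1, s, b) (some v)) (h.1 + 1) =
      fun t b' => (st.1 (h.1 + 1, t, b')).getD ⊥ := by
    funext t b'
    rw [tableVal, Function.update_of_ne (by simp)]
  simp only [this]
  simpa [tableVal] using h2

theorem val_updateLoop {Bhat : List (Key m)} (hB : Bhat ≠ []) (h : Fin M.H)
    (budgets : List (Key m)) (st : ValueTable M × AugPolicy M) :
    let st' := (Timed.loop (List.finRange M.S)
      (fun s => Timed.loop budgets (updateStep M f g ℓ Bhat h s)) st).val
    (∀ s, ∀ b ∈ budgets, IsSolvedAt M f g ℓ Bhat h s b st') ∧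
      ∀ k, k.1 ≠ h.1 → st'.1 k = st.1 k ∧ st'.2 k = st.2 k := by
  -- updating one entry again, or another entry of the same step, keeps the filled ones correct
  have keep : ∀ s b s' b' st, IsSolvedAt M f g ℓ Bhat h s' b' st →
      IsSolvedAt M f g ℓ Bhat h s' b' (updateStep M f g ℓ Bhat h s b st).val := by
    intro s b s' b' st hst
    obtain ⟨h1, h2⟩ := val_updateStep (f := f) (g := g) (ℓ := ℓ) hB h s b st
    by_cases heq : ((h.1, s', b') : ℕ × Fin M.S × Key m) = (h.1, s, b)
    · obtain ⟨rfl, rfl⟩ : s' = s ∧ b' = b := by simpa using heq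
      exact h1
    · exact hst.congr (h2 _ heq).1 (h2 _ heq).2 fun s'' b'' => (h2 _ (by simp)).1
  have other : ∀ s b st, ∀ k : ℕ × Fin M.S × Key m, k.1 ≠ h.1 →
      (updateStep M f g ℓ Bhat h s b st).val.1 k = st.1 k ∧
      (updateStep M f g ℓ Bhat h s b st).val.2 k = st.2 k := by
    intro s b st k hk
    refine (val_updateStep hB h s b st).2 k ?_
    rintro rfl
    exact hk rfl
  refine Timed.loop_invariant (List.finRange M.S) _ st (fun pre st' =>
    (∀ s ∈ pre, ∀ b ∈ budgets, IsSolvedAt M f g ℓ Bhat h s b st') ∧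
      ∀ k, k.1 ≠ h.1 → st'.1 k = st.1 k ∧ st'.2 k = st.2 k) ⟨by simp, by simp⟩ ?_ |>.imp
      (fun hh s => hh s (List.mem_finRange s)) id
  rintro pre s suf st₁ - ⟨i1, i2⟩
  have inner := Timed.loop_invariant budgets (updateStep M f g ℓ Bhat h s) st₁ (fun pre' st' =>
    (∀ s' ∈ pre, ∀ b ∈ budgets, IsSolvedAt M f g ℓ Bhat h s' b st') ∧
    (∀ b ∈ pre', IsSolvedAt M f g ℓ Bhat h s b st') ∧
      ∀ k, k.1 ≠ h.1 → st'.1 k = st.1 k ∧ st'.2 k = st.2 k) ⟨i1, by simp, i2⟩ ?_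
  · refine ⟨fun s' hs' => ?_, inner.2.2⟩
    rcases List.mem_append.1 hs' with hs' | hs'
    · exact inner.1 s' hs'
    · rw [List.mem_singleton.1 hs']
      exact inner.2.1
  · rintro pre' b suf' st₂ - ⟨j1, j2, j3⟩
    refine ⟨fun s' hs' b' hb' => keep _ _ _ _ _ (j1 s' hs' b' hb'), fun b' hb' => ?_,
      fun k hk => ⟨(other s b st₂ k hk).1.trans (j3 k hk).1,
        (other s b st₂ k hk).2.trans (j3 k hk).2⟩⟩
    rcases List.mem_append.1 hb' with hb' | hb'
    · exact keep _ _ _ _ _ (j2 b' hb')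
    · rw [List.mem_singleton.1 hb']
      exact (val_updateStep hB h s b st₂).1

variable (M f g ℓ)

theorem isBackwardSolution_approxBackwardInduction {Bhat : List (Key m)} (hB : Bhat ≠ [])
    (b₀ : Key m) :
    IsBackwardSolution M f g ℓ Bhat b₀
      (tableVal (approxBackwardInduction M f g ℓ Bhat b₀).val.1)
      (approxBackwardInduction M f g ℓ Bhat b₀).val.2 := by
  let V₀ : ValueTable M := (Timed.loop (List.finRange M.S) (fun s =>
    Timed.loop Bhat (fun b (V : ValueTable M) => do
      let ok ← Timed.charge m (decide (∀ i, 0 ≤ b i))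
      Table.write (m + 2) V (M.H, s, b) (if ok then 0 else ⊥))) Table.empty).val
  have hV₀ : ∀ s, ∀ b ∈ Bhat, tableVal V₀ M.H s b = if ∀ i, 0 ≤ b i then 0 else ⊥ := by
    have := Timed.loop_invariant (List.finRange M.S) (fun s =>
      Timed.loop Bhat (fun b (V : ValueTable M) => do
        let ok ← Timed.charge m (decide (∀ i, 0 ≤ b i))
        Table.write (m + 2) V (M.H, s, b) (if ok then 0 else ⊥))) Table.empty
      (fun pre V => ∀ s ∈ pre, ∀ b ∈ Bhat,
        tableVal V M.H s b = if ∀ i, 0 ≤ b i then 0 else ⊥)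
      (by simp) ?_
    · exact fun s => this s (List.mem_finRange s)
    rintro pre s suf V - hI
    have inner := Timed.loop_invariant Bhat (fun b (V : ValueTable M) => do
        let ok ← Timed.charge m (decide (∀ i, 0 ≤ b i))
        Table.write (m + 2) V (M.H, s, b) (if ok then 0 else ⊥)) V
      (fun pre' V => (∀ s ∈ pre, ∀ b ∈ Bhat,
          tableVal V M.H s b = if ∀ i, 0 ≤ b i then 0 else ⊥) ∧
        ∀ b ∈ pre', tableVal V M.H s b = if ∀ i, 0 ≤ b i then 0 else ⊥) ⟨hI, by simp⟩ ?_
    · intro s' hs'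
      rcases List.mem_append.1 hs' with hs' | hs'
      · exact inner.1 s' hs'
      · rw [List.mem_singleton.1 hs']
        exact inner.2
    · rintro pre' b suf' V' - ⟨j1, j2⟩
      simp only [Timed.val_bind, Timed.val_charge, Table.val_write, decide_eq_true_eq]
      have upd : ∀ s' b', (tableVal V' M.H s' b' = if ∀ i, 0 ≤ b' i then 0 else ⊥) →
          tableVal (Function.update V' (M.H, s, b) (some (if ∀ i, 0 ≤ b i then 0 else ⊥)))
            M.H s' b' = if ∀ i, 0 ≤ b' i then 0 else ⊥ := by
        intro s' b' hh
        by_cases heq : ((M.H, s', b') : ℕ × Fin M.S × Key m) = (M.H, s, b)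
        · obtain ⟨rfl, rfl⟩ : s' = s ∧ b' = b := by simpa using heq
          simp [tableVal]
        · rw [tableVal, Function.update_of_ne heq]
          exact hh
      refine ⟨fun s' hs' b' hb' => upd _ _ (j1 s' hs' b' hb'), fun b' hb' => ?_⟩
      rcases List.mem_append.1 hb' with hb' | hb'
      · exact upd _ _ (j2 b' hb')
      · rw [List.mem_singleton.1 hb']
        simp [tableVal]
  have key := Timed.loop_invariant (List.finRange M.H).reverse (fun h st => do
    let budgets ← Timed.op (if h.1 = 0 then b₀ :: Bhat else Bhat)
    Timed.loop (List.finRange M.S) (fun s => Timed.loop budgets (updateStep M f g ℓ Bhat h s)) st)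
    (V₀, Table.empty)
    (fun pre st => (∀ s, ∀ b ∈ Bhat,
        tableVal st.1 M.H s b = if ∀ i, 0 ≤ b i then 0 else ⊥) ∧
      ∀ h ∈ pre, ∀ s, ∀ b ∈ budgetsAt Bhat b₀ h.1, IsSolvedAt M f g ℓ Bhat h s b st)
    ⟨hV₀, by simp⟩ ?_
  · exact ⟨key.1, fun h => key.2 h (by simp)⟩
  rintro pre h suf st hl ⟨i1, i2⟩
  have hgt : ∀ h' ∈ pre, h < h' := by
    have h4 := List.pairwise_lt_finRange M.H
    rw [← List.pairwise_reverse, hl, List.pairwise_append] at h4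
    exact fun t' ht' => h4.2.2 t' ht' h (by simp)
  obtain ⟨j1, j2⟩ := val_updateLoop (f := f) (g := g) (ℓ := ℓ) hB h
    (budgetsAt Bhat b₀ h.1) st
  simp only [Timed.val_bind, Timed.val_op]
  refine ⟨fun s b hb => ?_, fun h' hh' s b hb => ?_⟩
  · rw [← i1 s b hb, tableVal, tableVal]
    exact congrArg (fun x => Option.getD x ⊥) (j2 _ (by simp only; have := h.2; omega)).1
  · rcases List.mem_append.1 hh' with hh' | hh'
    · have hlt := Fin.lt_def.1 (hgt h' hh')
      exact (i2 h' hh' s b hb).congr (j2 _ (by simp only; omega)).1 (j2 _ (by simp only; omega)).2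
        fun s' b' => (j2 _ (by simp only; omega)).1
    · rw [List.mem_singleton.1 hh'] at hb ⊢
      exact j1 s b hb

end Backward

/-! ### The grid of budgets -/

/-- A loop whose iterations preserve `I`, extend the state along `R` and establish properties `Q i`
that survive extensions. -/
theorem Timed.loop_extend {ι σ : Type} (I : σ → Prop) (R : σ → σ → Prop) (hrefl : ∀ x, R x x)
    (htrans : ∀ x y z, R x y → R y z → R x z) (Q : ι → σ → Prop)
    (hQ : ∀ i x y, Q i x → R x y → Q i y) (l : List ι) (body : ι → σ → Timed σ)
    (hbody : ∀ i st, I st → I (body i st).val ∧ R st (body i st).val ∧ Q i (body i st).val)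
    (st : σ) (hst : I st) :
    I (loop l body st).val ∧ R st (loop l body st).val ∧ ∀ i ∈ l, Q i (loop l body st).val := by
  refine Timed.loop_invariant l body st (fun pre st' => I st' ∧ R st st' ∧ ∀ i ∈ pre, Q i st')
    ⟨hst, hrefl _, by simp⟩ ?_
  rintro pre i suf st' - ⟨h1, h2, h3⟩
  obtain ⟨j1, j2, j3⟩ := hbody i st' h1
  refine ⟨j1, htrans _ _ _ h2 j2, fun i' hi' => ?_⟩
  rcases List.mem_append.1 hi' with hi' | hi'
  · exact hQ _ _ _ (h3 i' hi') j2
  · rw [List.mem_singleton.1 hi']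
    exact j3

theorem mem_costValues (M : CaMDP m) {h : Fin M.H} {s : Fin M.S} {a : Fin M.A}
    (ha : a ∈ M.act h s) (i : Fin m) : M.c h s a i ∈ M.costValues i := by
  refine Finset.mem_insert_of_mem (Finset.mem_image.2 ⟨(h, s, a), ?_, rfl⟩)
  simpa using ha

theorem abs_c_le (M : CaMDP m) {h : Fin M.H} {s : Fin M.S} {a : Fin M.A}
    (ha : a ∈ M.act h s) (i : Fin m) : |M.c h s a i| ≤ ‖M.cMax - M.cMin‖ := by
  have h1 : M.cMin i ≤ M.c h s a i := Finset.min'_le _ _ (mem_costValues M ha i)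
  have h2 : M.c h s a i ≤ M.cMax i := Finset.le_max' _ _ (mem_costValues M ha i)
  have h3 : M.cMin i ≤ 0 := Finset.min'_le _ _ (Finset.mem_insert_self _ _)
  have h4 : 0 ≤ M.cMax i := Finset.le_max' _ _ (Finset.mem_insert_self _ _)
  have h5 := (le_abs_self _).trans (norm_le_pi_norm (M.cMax - M.cMin) i)
  rw [Pi.sub_apply] at h5
  rw [abs_le]
  constructor <;> linarith

theorem costRange_spec (M : CaMDP m) :
    ((costRange M).val.1 ∈ Set.Icc (-‖M.cMax - M.cMin‖) 0 ∧
      (costRange M).val.2 ∈ Set.Icc 0 ‖M.cMax - M.cMin‖) ∧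
    ∀ h s, ∀ a ∈ M.act h s, ∀ i,
      M.c h s a i ∈ Set.Icc (costRange M).val.1 (costRange M).val.2 := by
  set D := ‖M.cMax - M.cMin‖ with hD
  have hD0 : 0 ≤ D := norm_nonneg _
  let I : ℝ × ℝ → Prop := fun st => st.1 ∈ Set.Icc (-D) 0 ∧ st.2 ∈ Set.Icc 0 D
  let R : ℝ × ℝ → ℝ × ℝ → Prop := fun st st' => st'.1 ≤ st.1 ∧ st.2 ≤ st'.2
  have hrefl : ∀ x, R x x := fun x => ⟨le_rfl, le_rfl⟩
  have htrans : ∀ x y z, R x y → R y z → R x z :=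
    fun x y z h1 h2 => ⟨h2.1.trans h1.1, h1.2.trans h2.2⟩
  have hmem : ∀ (x y : ℝ × ℝ) (t : ℝ), t ∈ Set.Icc x.1 x.2 → R x y → t ∈ Set.Icc y.1 y.2 :=
    fun x y t h1 h2 => ⟨h2.1.trans h1.1, h1.2.trans h2.2⟩
  have key := Timed.loop_extend I R hrefl htrans
    (fun h st => ∀ s, ∀ a ∈ M.act h s, ∀ i, M.c h s a i ∈ Set.Icc st.1 st.2)
    (fun h x y h1 h2 s a ha i => hmem _ _ _ (h1 s a ha i) h2) (List.finRange M.H)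
    (fun h => Timed.loop (List.finRange M.S) (fun s =>
      Timed.loop (List.finRange M.A) (fun a st => do
        let ok ← Timed.op (decide (a ∈ M.act h s))
        if ok then
          Timed.loop (List.finRange m) (fun i st => do
            let x ← Timed.op (M.c h s a i)
            let lo ← Timed.op (min st.1 x)
            let hi ← Timed.op (max st.2 x)
            pure (lo, hi)) st
        else pure st))) ?_ (0, 0) ⟨⟨by linarith, le_rfl⟩, ⟨le_rfl, hD0⟩⟩
  · exact ⟨key.1, fun h => key.2.2 h (List.mem_finRange h)⟩
  intro h st hst
  have key := Timed.loop_extend I R hrefl htrans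
    (fun s st => ∀ a ∈ M.act h s, ∀ i, M.c h s a i ∈ Set.Icc st.1 st.2)
    (fun s x y h1 h2 a ha i => hmem _ _ _ (h1 a ha i) h2) (List.finRange M.S)
    (fun s => Timed.loop (List.finRange M.A) (fun a st => do
        let ok ← Timed.op (decide (a ∈ M.act h s))
        if ok then
          Timed.loop (List.finRange m) (fun i st => do
            let x ← Timed.op (M.c h s a i)
            let lo ← Timed.op (min st.1 x)
            let hi ← Timed.op (max st.2 x)
            pure (lo, hi)) st
        else pure st)) ?_ st hst
  · exact ⟨key.1, key.2.1, fun s => key.2.2 s (List.mem_finRange s)⟩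
  intro s st hst
  have key := Timed.loop_extend I R hrefl htrans
    (fun a st => a ∈ M.act h s → ∀ i, M.c h s a i ∈ Set.Icc st.1 st.2)
    (fun a x y h1 h2 ha i => hmem _ _ _ (h1 ha i) h2) (List.finRange M.A)
    (fun a st => do
        let ok ← Timed.op (decide (a ∈ M.act h s))
        if ok then
          Timed.loop (List.finRange m) (fun i st => do
            let x ← Timed.op (M.c h s a i)
            let lo ← Timed.op (min st.1 x)
            let hi ← Timed.op (max st.2 x)
            pure (lo, hi)) st
        else pure st) ?_ st hst
  · exact ⟨key.1, key.2.1, fun a => key.2.2 a (List.mem_finRange a)⟩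
  intro a st hst
  by_cases ha : a ∈ M.act h s
  · simp only [Timed.val_bind, Timed.val_op, ha, decide_true, if_true]
    have key := Timed.loop_extend I R hrefl htrans
      (fun i st => M.c h s a i ∈ Set.Icc st.1 st.2)
      (fun i x y h1 h2 => hmem _ _ _ h1 h2) (List.finRange m)
      (fun i st => do
            let x ← Timed.op (M.c h s a i)
            let lo ← Timed.op (min st.1 x)
            let hi ← Timed.op (max st.2 x)
            pure (lo, hi)) ?_ st hst
    · exact ⟨key.1, key.2.1, fun _ i => key.2.2 i (List.mem_finRange i)⟩
    intro i st hst
    have hc := abs_le.1 (abs_c_le M ha i)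
    exact ⟨⟨⟨le_min hst.1.1 hc.1, (min_le_left _ _).trans hst.1.2⟩,
      ⟨hst.2.1.trans (le_max_left _ _), max_le hst.2.2 hc.2⟩⟩,
      ⟨min_le_left _ _, le_max_left _ _⟩, min_le_right _ _, le_max_right _ _⟩
  · simp only [Timed.val_bind, Timed.val_op, ha, decide_false]
    exact ⟨hst, hrefl _, fun h => absurd h (by simp)⟩

theorem mem_box {lo hi : ℤ} {b : Key m} : b ∈ box m lo hi ↔ ∀ i, b i ∈ Set.Icc lo hi := by
  simp [box]

theorem length_box (lo hi : ℤ) : (box m lo hi).length = (hi + 1 - lo).toNat ^ m := by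
  simp [box]

theorem val_budgetGrid (M : CaMDP m) (ℓ : ℝ) :
    (budgetGrid M ℓ).val =
      box m ⌈M.H * (costRange M).val.1 / ℓ⌉ ⌈M.H * (costRange M).val.2 / ℓ⌉ := rfl

theorem roundUp_mem_budgetGrid (M : CaMDP m) {ℓ : ℝ} (hℓ : 0 < ℓ) {x : Vec m}
    (hx : ∀ i, x i ∈ Set.Icc (M.H * (costRange M).val.1) (M.H * (costRange M).val.2)) :
    roundUp ℓ x ∈ (budgetGrid M ℓ).val := by
  rw [val_budgetGrid, mem_box]
  refine fun i => ⟨Int.ceil_le_ceil ?_, Int.ceil_le_ceil ?_⟩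
  · exact div_le_div_of_nonneg_right (hx i).1 hℓ.le
  · exact div_le_div_of_nonneg_right (hx i).2 hℓ.le

theorem budgetGrid_ne_nil (M : CaMDP m) {ℓ : ℝ} (hℓ : 0 < ℓ) : (budgetGrid M ℓ).val ≠ [] := by
  obtain ⟨⟨h1, h2⟩, -⟩ := costRange_spec M
  refine List.ne_nil_of_mem (roundUp_mem_budgetGrid M hℓ (x := 0) fun i => ⟨?_, ?_⟩)
  · exact mul_nonpos_of_nonneg_of_nonpos (Nat.cast_nonneg _) h1.2
  · exact mul_nonneg (Nat.cast_nonneg _) h2.1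

/-! ### Optimality of the approximate values -/

/-- The recursion of a shortly recursive criterion along `π`. -/
structure IsCostRecursion {M : CaMDP m} (f : Vec m → Vec m → Vec m) (g : ℝ → Vec m)
    (π : Policy M) (Ch : M.Past → Fin M.S → Vec m) : Prop where
  last : ∀ τ s, τ.length = M.H → Ch τ s = 0
  step : ∀ (τ : M.Past) (s : Fin M.S) (h : τ.length < M.H),
    Ch τ s = M.c ⟨τ.length, h⟩ s (π.act τ s) +
      weightedComb f g (M.P ⟨τ.length, h⟩ s (π.act τ s)) fun s' => Ch (τ ++ [(s, π.act τ s)]) s'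

section Correctness

variable {M : CaMDP m} {f : Vec m → Vec m → Vec m} {g : ℝ → Vec m} {ℓ : ℝ}

theorem IsCostRecursion.mem_Icc (hfg : IsShortPair f g) {π : Policy M}
    {Ch : M.Past → Fin M.S → Vec m} (hCh : IsCostRecursion f g π Ch) {lo hi : ℝ} (hlo : lo ≤ 0)
    (hhi : 0 ≤ hi) (hc : ∀ h s, ∀ a ∈ M.act h s, ∀ i, M.c h s a i ∈ Set.Icc lo hi) (n : ℕ)
    (τ : M.Past) (s : Fin M.S) (hn : τ.length + n = M.H) (i : Fin m) :
    Ch τ s i ∈ Set.Icc (n * lo) (n * hi) := by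
  induction n generalizing τ s i with
  | zero =>
    rw [hCh.last τ s (by omega)]
    simp
  | succ n ih =>
    have hτ : τ.length < M.H := by omega
    have h1 := hc _ _ _ (π.mem τ s hτ) i
    have h2 := hfg.weightedComb_mem_Icc (M.P_mem _ _ _ (π.mem τ s hτ))
      (x := fun s' => Ch (τ ++ [(s, π.act τ s)]) s')
      (mul_nonpos_of_nonneg_of_nonpos (Nat.cast_nonneg n) hlo)
      (mul_nonneg (Nat.cast_nonneg n) hhi)
      (fun s' i => ih (τ ++ [(s, π.act τ s)]) s' (by simp; omega) i) i
    rw [hCh.step τ s hτ, Pi.add_apply]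
    push_cast
    constructor
    · linarith [h1.1, h2.1]
    · linarith [h1.2, h2.2]

theorem mem_budgetsAt {Bhat : List (Key m)} {b₀ b : Key m} (hb : b ∈ Bhat) (h : ℕ) :
    b ∈ budgetsAt Bhat b₀ h := by
  rw [budgetsAt]
  split_ifs
  · exact List.mem_cons_of_mem _ hb
  · exact hb

theorem coe_sum_mul {n : ℕ} (p v : Fin n → ℝ) :
    ((∑ t, p t * v t : ℝ) : EReal) = ∑ t, (p t : EReal) * (v t : EReal) := by
  have key : ∀ A : Finset (Fin n), ((∑ t ∈ A, p t * v t : ℝ) : EReal) =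
      ∑ t ∈ A, (p t : EReal) * (v t : EReal) := by
    intro A
    induction A using Finset.induction_on with
    | empty => simp
    | insert t A ht ih =>
      rw [Finset.sum_insert ht, Finset.sum_insert ht, EReal.coe_add, EReal.coe_mul, ih]
  exact key Finset.univ

/-- Following `π` with its exact costs, rounded up, as budgets is one of the options of the
algorithm: the value of `π` is at most the computed value. -/
theorem valueFrom_le (hfg : IsShortPair f g) (hℓ : 0 < ℓ) {Bhat : List (Key m)} {b₀ : Key m}
    {V : ℕ → Fin M.S → Key m → EReal} {Q : AugPolicy M}
    (hVQ : IsBackwardSolution M f g ℓ Bhat b₀ V Q) {π : Policy M}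
    {Ch : M.Past → Fin M.S → Vec m} (hCh : IsCostRecursion f g π Ch)
    (hgrid : ∀ τ s, τ.length ≤ M.H → roundUp ℓ (Ch τ s) ∈ Bhat) (n : ℕ) (τ : M.Past)
    (s : Fin M.S) (hn : τ.length + n = M.H) (b : Key m) (hb : b ∈ budgetsAt Bhat b₀ τ.length)
    (hCb : ∀ i, Ch τ s i ≤ toVec ℓ b i) :
    (π.valueFrom n τ s : EReal) ≤ V τ.length s b := by
  induction n generalizing τ s b with
  | zero =>
    have hτ : τ.length = M.H := by omega
    have hb' : b ∈ Bhat := by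
      rw [budgetsAt, if_neg (by have := M.H_pos; omega)] at hb
      exact hb
    have h0 : ∀ i, 0 ≤ b i := by
      intro i
      have h1 := hCb i
      rw [hCh.last τ s hτ, toVec, Pi.zero_apply] at h1
      have h2 := (mul_nonneg_iff_of_pos_right hℓ).1 h1
      exact_mod_cast h2
    rw [hτ, hVQ.last s b hb', if_pos h0, Policy.valueFrom_zero, EReal.coe_zero]
  | succ n ih =>
    have hτ : τ.length < M.H := by omega
    set h : Fin M.H := ⟨τ.length, hτ⟩ with hh
    set a := π.act τ s with ha
    have hact : a ∈ M.act h s := π.mem τ s hτ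
    have hP := M.P_mem h s a hact
    let β : Fin M.S → Key m := fun t => roundUp ℓ (Ch (τ ++ [(s, a)]) t)
    have hβ : ∀ t, β t ∈ Bhat := fun t => hgrid _ _ (by simp; omega)
    obtain ⟨a', w, -, hbest⟩ := hVQ.step h s b hb
    refine le_trans ?_ (hbest.le a hact β hβ)
    have hbase : dpBase M ℓ h s a b (roundedCost M f g ℓ h s a β) = 0 := by
      rw [dpBase, if_pos]
      intro i
      have h1 := hfg.roundedPrefix_le_weightedComb hℓ (M.P h s a) β i
      have h2 := hfg.weightedComb_le_add hP (x := fun t => toVec ℓ (β t))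
        (y := fun t => Ch (τ ++ [(s, a)]) t) hℓ.le (fun t i => by
          have h3 := le_toVec_roundUp hℓ (Ch (τ ++ [(s, a)]) t) i
          have h4 := toVec_roundUp_le hℓ (Ch (τ ++ [(s, a)]) t) i
          rw [abs_of_nonneg (by linarith)]
          linarith) i
      have h5 := hCb i
      rw [hCh.step τ s hτ, Pi.add_apply] at h5
      rw [roundedCost]
      linarith
    rw [actionValue, hbase, add_zero, Policy.valueFrom_succ π n τ s hτ, EReal.coe_add,
      coe_sum_mul]
    refine add_le_add le_rfl (Finset.sum_le_sum fun t _ => ?_)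
    refine mul_le_mul_of_nonneg_left ?_ (EReal.coe_nonneg.2 (hP.1 t))
    have h6 := ih (τ ++ [(s, a)]) t (by simp; omega) (β t) (mem_budgetsAt (hβ t) _)
      (fun i => le_toVec_roundUp hℓ _ i)
    rw [List.length_append, List.length_singleton] at h6
    exact h6

/-! ### Deploying the computed policy -/

/-- The current state and budget when `Q`, started in `s` with budget `b` at step `k`, has visited
the states in the list. -/
def track (Q : AugPolicy M) : ℕ → Key m → Fin M.S → List (Fin M.S) → Option (Fin M.S × Key m)
  | _, b, s, [] => some (s, b)
  | k, b, s, s' :: l =>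
    match (Q (k, s, b)).bind fun e => e.2 s' with
    | none => none
    | some b' => track Q (k + 1) b' s' l

theorem runAug_eq_track (Q : AugPolicy M) (k : ℕ) (b : Key m) (s : Fin M.S)
    (l : List (Fin M.S)) : runAug Q k b s l =
      (track Q k b s l).bind fun x => (Q (k + l.length, x.1, x.2)).map Prod.fst := by
  induction l generalizing k b s with
  | nil => rfl
  | cons s' l ih =>
    rw [runAug, track]
    cases (Q (k, s, b)).bind fun e => e.2 s' with
    | none => rfl
    | some b' =>
      simp only [ih, List.length_cons]
      rw [show k + 1 + l.length = k + (l.length + 1) by omega]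

theorem track_append (Q : AugPolicy M) (k : ℕ) (b : Key m) (s : Fin M.S) (l : List (Fin M.S))
    (t : Fin M.S) : track Q k b s (l ++ [t]) =
      (track Q k b s l).bind fun x =>
        ((Q (k + l.length, x.1, x.2)).bind fun e => e.2 t).map fun b' => (t, b') := by
  induction l generalizing k b s with
  | nil =>
    simp only [List.nil_append, track, List.length_nil, add_zero, Option.bind_some]
    cases (Q (k, s, b)).bind fun e => e.2 t <;> rfl
  | cons s' l ih =>
    rw [List.cons_append, track, track]
    cases (Q (k, s, b)).bind fun e => e.2 s' with
    | none => rfl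
    | some b' =>
      simp only [ih, List.length_cons]
      rw [show k + 1 + l.length = k + (l.length + 1) by omega]

/-- The current state and budget at the history `(τ, s)`. -/
def trackPast (Q : AugPolicy M) (b₀ : Key m) (τ : M.Past) (s : Fin M.S) :
    Option (Fin M.S × Key m) :=
  match τ.map Prod.fst ++ [s] with
  | [] => none
  | s₁ :: l => track Q 0 b₀ s₁ l

theorem deploy_eq_trackPast (Q : AugPolicy M) (b₀ : Key m) (τ : M.Past) (s : Fin M.S) :
    deploy Q b₀ τ s =
      (trackPast Q b₀ τ s).bind fun x => (Q (τ.length, x.1, x.2)).map Prod.fst := by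
  cases τ with
  | nil => simp [deploy, trackPast, runAug_eq_track]
  | cons p τ => simp [deploy, trackPast, runAug_eq_track]

theorem trackPast_append (Q : AugPolicy M) (b₀ : Key m) (τ : M.Past) (s : Fin M.S) (a : Fin M.A)
    (t : Fin M.S) : trackPast Q b₀ (τ ++ [(s, a)]) t =
      (trackPast Q b₀ τ s).bind fun x =>
        ((Q (τ.length, x.1, x.2)).bind fun e => e.2 t).map fun b' => (t, b') := by
  cases τ with
  | nil => exact track_append Q 0 b₀ s [] t
  | cons p τ =>
    simp only [trackPast, List.cons_append, List.map_cons, List.map_append, List.map_nil]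
    rw [track_append]
    simp

theorem trackPast_eq_some {Bhat : List (Key m)} {b₀ : Key m}
    {V : ℕ → Fin M.S → Key m → EReal} {Q : AugPolicy M}
    (hVQ : IsBackwardSolution M f g ℓ Bhat b₀ V Q) (τ : M.Past) (s : Fin M.S)
    (hτ : τ.length ≤ M.H) :
    ∃ b ∈ budgetsAt Bhat b₀ τ.length, trackPast Q b₀ τ s = some (s, b) := by
  induction τ using List.reverseRecOn generalizing s with
  | nil => exact ⟨b₀, by simp [budgetsAt], rfl⟩
  | append_singleton τ p ih =>
    obtain ⟨s', a'⟩ := p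
    rw [List.length_append, List.length_singleton] at hτ ⊢
    obtain ⟨b, hb, hbt⟩ := ih s' (by omega)
    obtain ⟨a, w, hQ, hbest⟩ := hVQ.step ⟨τ.length, hτ⟩ s' b hb
    obtain ⟨β, hw, hβ, -⟩ := hbest.exists_budgets
    simp only at hQ
    refine ⟨β s, mem_budgetsAt (hβ s) _, ?_⟩
    rw [trackPast_append, hbt, Option.bind_some, hQ, Option.bind_some]
    simp only [hw]
    rfl

theorem exists_deploys {Bhat : List (Key m)} {b₀ : Key m}
    {V : ℕ → Fin M.S → Key m → EReal} {Q : AugPolicy M}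
    (hVQ : IsBackwardSolution M f g ℓ Bhat b₀ V Q) : ∃ π : Policy M, Deploys Q b₀ π := by
  classical
  have hex : ∀ τ s, ∃ a : Fin M.A, ∀ h : τ.length < M.H,
      deploy Q b₀ τ s = some a ∧ a ∈ M.act ⟨τ.length, h⟩ s := by
    intro τ s
    by_cases h : τ.length < M.H
    · obtain ⟨b, hb, hbt⟩ := trackPast_eq_some hVQ τ s h.le
      obtain ⟨a, w, hQ, hbest⟩ := hVQ.step ⟨τ.length, h⟩ s b hb
      simp only at hQ
      refine ⟨a, fun _ => ⟨?_, hbest.mem⟩⟩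
      rw [deploy_eq_trackPast, hbt, Option.bind_some, hQ]
      rfl
    · obtain ⟨a, -⟩ := M.act_nonempty ⟨0, M.H_pos⟩ s
      exact ⟨a, fun h' => absurd h' h⟩
  choose act hact using hex
  exact ⟨⟨act, fun τ s h => (hact τ s h).2⟩, fun τ s h => (hact τ s h).1⟩

theorem sum_ne_bot {n : ℕ} {v : Fin n → EReal} (h : ∑ t, v t ≠ ⊥) (t : Fin n) : v t ≠ ⊥ := by
  intro ht
  apply h
  rw [← Finset.add_sum_erase _ _ (Finset.mem_univ t), ht, EReal.bot_add]

/-- Wherever the computed value is finite, the deployed policy attains it, and its cost exceeds the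
current budget by at most the slack `(S + 1) ℓ` for each remaining step. -/
theorem deployed_value_and_cost (hfg : IsShortPair f g) (hℓ : 0 < ℓ) {Bhat : List (Key m)}
    {b₀ : Key m} {V : ℕ → Fin M.S → Key m → EReal} {Q : AugPolicy M}
    (hVQ : IsBackwardSolution M f g ℓ Bhat b₀ V Q) {π : Policy M} (hπ : Deploys Q b₀ π)
    {Ch : M.Past → Fin M.S → Vec m} (hCh : IsCostRecursion f g π Ch) (n : ℕ) (τ : M.Past)
    (s : Fin M.S) (hn : τ.length + n = M.H) (b : Key m) (hb : b ∈ budgetsAt Bhat b₀ τ.length)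
    (hbt : trackPast Q b₀ τ s = some (s, b)) (hV : V τ.length s b ≠ ⊥) :
    V τ.length s b = (π.valueFrom n τ s : EReal) ∧
      ∀ i, Ch τ s i ≤ toVec ℓ b i + n * (((M.S : ℝ) + 1) * ℓ) := by
  induction n generalizing τ s b with
  | zero =>
    have hτ : τ.length = M.H := by omega
    have hb' : b ∈ Bhat := by
      rw [budgetsAt, if_neg (by have := M.H_pos; omega)] at hb
      exact hb
    rw [hτ, hVQ.last s b hb'] at hV ⊢
    have h0 : ∀ i, 0 ≤ b i := by
      by_contra hc
      exact hV (if_neg hc)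
    rw [if_pos h0, Policy.valueFrom_zero, EReal.coe_zero]
    refine ⟨rfl, fun i => ?_⟩
    rw [hCh.last τ s hτ, toVec]
    have : (0 : ℝ) ≤ b i := by exact_mod_cast h0 i
    simp only [Pi.zero_apply, Nat.cast_zero, zero_mul, add_zero]
    positivity
  | succ n ih =>
    have hτ : τ.length < M.H := by omega
    obtain ⟨a, w, hQ, hbest⟩ := hVQ.step ⟨τ.length, hτ⟩ s b hb
    obtain ⟨β, hw, hβ, hval⟩ := hbest.exists_budgets
    simp only at hQ hval
    have ha : π.act τ s = a := by
      have h1 := hπ τ s hτ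
      rw [deploy_eq_trackPast, hbt, Option.bind_some, hQ] at h1
      simpa using h1.symm
    set h : Fin M.H := ⟨τ.length, hτ⟩ with hh
    have hP := M.P_mem h s a hbest.mem
    rw [hval, actionValue] at hV
    have hV1 : (∑ t, (M.P h s a t : EReal) * V (τ.length + 1) t (β t)) +
        dpBase M ℓ h s a b (roundedCost M f g ℓ h s a β) ≠ ⊥ := by
      intro hc
      exact hV (by rw [hc, EReal.add_bot])
    have hsum : ∑ t, (M.P h s a t : EReal) * V (τ.length + 1) t (β t) ≠ ⊥ := by
      intro hc
      exact hV1 (by rw [hc, EReal.bot_add])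
    have hbase : ∀ i, M.c h s a i + toVec ℓ (roundedCost M f g ℓ h s a β) i ≤
        toVec ℓ b i + ℓ * ((M.S : ℝ) + 1) := by
      by_contra hc
      exact hV1 (by rw [dpBase, if_neg hc, EReal.add_bot])
    -- successors of positive probability have finite values
    have hnext : ∀ t, M.P h s a t ≠ 0 →
        V (τ.length + 1) t (β t) = (π.valueFrom n (τ ++ [(s, a)]) t : EReal) ∧
        ∀ i, Ch (τ ++ [(s, a)]) t i ≤ toVec ℓ (β t) i + n * (((M.S : ℝ) + 1) * ℓ) := by
      intro t ht
      have hpos : 0 < M.P h s a t := lt_of_le_of_ne (hP.1 t) (Ne.symm ht)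
      have hlen : (τ ++ [(s, a)]).length = τ.length + 1 := by simp
      have h1 := ih (τ ++ [(s, a)]) t (by rw [hlen]; omega) (β t) (mem_budgetsAt (hβ t) _) (by
        rw [trackPast_append, hbt, Option.bind_some, hQ, Option.bind_some]
        simp only [hw]
        rfl)
      rw [hlen] at h1
      refine h1 fun hc => sum_ne_bot hsum t ?_
      rw [hc, EReal.coe_mul_bot_of_pos hpos]
    constructor
    · rw [hval, actionValue, dpBase, if_pos hbase, add_zero, Policy.valueFrom_succ π n τ s hτ, ha,
        EReal.coe_add, coe_sum_mul]
      congr 1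
      refine Finset.sum_congr rfl fun t _ => ?_
      by_cases ht : M.P h s a t = 0
      · rw [ht]
        simp
      · rw [(hnext t ht).1]
    · intro i
      set δ : ℝ := n * (((M.S : ℝ) + 1) * ℓ) with hδ
      have hδ0 : 0 ≤ δ := by positivity
      -- the costs of successors of probability `0` do not matter
      let x : Fin M.S → Vec m := fun t =>
        if M.P h s a t = 0 then toVec ℓ (β t) else Ch (τ ++ [(s, a)]) t
      have h1 : weightedComb f g (M.P h s a) (fun t => Ch (τ ++ [(s, a)]) t) =
          weightedComb f g (M.P h s a) x :=
        hfg.weightedComb_congr fun t ht => by simp [x, ht]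
      have h2 : x ≤ fun t i => toVec ℓ (β t) i + δ := by
        intro t i
        by_cases ht : M.P h s a t = 0
        · simp only [x, ht, if_true]
          linarith
        · simp only [x, ht, if_false]
          exact (hnext t ht).2 i
      have h3 := hfg.weightedComb_mono hP h2 i
      have h4 := hfg.weightedComb_le_add hP (x := fun t i => toVec ℓ (β t) i + δ)
        (y := fun t => toVec ℓ (β t)) hδ0 (fun t i => by simp [abs_of_nonneg hδ0]) i
      have h5 := hfg.weightedComb_le_roundedPrefix hℓ (M.P h s a) β i
      have h6 := hbase i
      rw [roundedCost] at h6
      rw [hCh.step τ s hτ, ha, Pi.add_apply, h1]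
      push_cast
      linarith

theorem exists_isCostRecursion {C : CostCriterion m} (hC : IsSR C f g) (π : Policy M) :
    ∃ Ch, C M π = Ch [] M.s₀ ∧ IsCostRecursion f g π Ch := by
  obtain ⟨Ch, h1, h2, h3⟩ := hC.2 M π
  exact ⟨Ch, h1, h2, h3⟩

/-- The exact costs of a policy, rounded up, belong to the grid. -/
theorem roundUp_cost_mem_budgetGrid (hfg : IsShortPair f g) (hℓ : 0 < ℓ) {π : Policy M}
    {Ch : M.Past → Fin M.S → Vec m} (hCh : IsCostRecursion f g π Ch) (τ : M.Past) (s : Fin M.S)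
    (hτ : τ.length ≤ M.H) : roundUp ℓ (Ch τ s) ∈ (budgetGrid M ℓ).val := by
  obtain ⟨⟨h1, h2⟩, h3⟩ := costRange_spec M
  refine roundUp_mem_budgetGrid M hℓ fun i => ?_
  have h4 := hCh.mem_Icc hfg h1.2 h2.1 h3 (M.H - τ.length) τ s (by omega) i
  have h5 : ((M.H - τ.length : ℕ) : ℝ) ≤ M.H := by exact_mod_cast Nat.sub_le _ _
  exact ⟨(mul_le_mul_of_nonpos_right h5 h1.2).trans h4.1,
    h4.2.trans (mul_le_mul_of_nonneg_right h5 h2.1)⟩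

variable (M f g)

/-- The computed value at the initial state and budget. -/
noncomputable def outputValue (B : Vec m) (ℓ : ℝ) : EReal :=
  tableVal (approxBackwardInduction M f g ℓ (budgetGrid M ℓ).val (roundUp ℓ B)).val.1 0 M.s₀
    (roundUp ℓ B)

theorem val_bicriteria (B : Vec m) (ℓ : ℝ) :
    (bicriteria M f g B ℓ).val = if outputValue M f g B ℓ = ⊥ then none else
      some (approxBackwardInduction M f g ℓ (budgetGrid M ℓ).val (roundUp ℓ B)).val.2 := by
  simp only [bicriteria, Timed.val_bind, Timed.val_charge, Table.val_read, Timed.val_op,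
    Timed.val_pure]
  exact if_congr decide_eq_true_iff rfl rfl

variable {M f g}

theorem value_le_outputValue {C : CostCriterion m} (hC : IsSR C f g) (hℓ : 0 < ℓ) (B : Vec m)
    (π : Policy M) (hπ : C M π ≤ B) : (π.value : EReal) ≤ outputValue M f g B ℓ := by
  obtain ⟨Ch, h0, hCh⟩ := exists_isCostRecursion hC π
  have hVQ := isBackwardSolution_approxBackwardInduction M f g ℓ (budgetGrid_ne_nil M hℓ)
    (roundUp ℓ B)
  rw [Policy.value_eq_valueFrom]
  refine valueFrom_le hC.1 hℓ hVQ hCh (roundUp_cost_mem_budgetGrid hC.1 hℓ hCh) M.H [] M.s₀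
    (by simp) (roundUp ℓ B) (by simp [budgetsAt]) fun i => ?_
  rw [← h0]
  exact (hπ i).trans (le_toVec_roundUp hℓ B i)

theorem deployed_approx {C : CostCriterion m} (hC : IsSR C f g) {ε : ℝ} (hε : 0 < ε) (B : Vec m)
    (hV : outputValue M f g B (unit M ε) ≠ ⊥) :
    ∃ π : Policy M, Deploys (approxBackwardInduction M f g (unit M ε)
        (budgetGrid M (unit M ε)).val (roundUp (unit M ε) B)).val.2 (roundUp (unit M ε) B) π ∧
      IsBicriteriaApprox 0 ε C M B π := by
  have hden : (0 : ℝ) < 1 + ((M.S : ℝ) + 1) * M.H := by positivity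
  have hℓ : 0 < unit M ε := div_pos hε hden
  have hℓε : unit M ε * (1 + ((M.S : ℝ) + 1) * M.H) = ε := div_mul_cancel₀ _ hden.ne'
  have hVQ := isBackwardSolution_approxBackwardInduction M f g (unit M ε)
    (budgetGrid_ne_nil M hℓ) (roundUp (unit M ε) B)
  obtain ⟨π, hπ⟩ := exists_deploys hVQ
  obtain ⟨Ch, h0, hCh⟩ := exists_isCostRecursion hC π
  obtain ⟨h1, h2⟩ := deployed_value_and_cost hC.1 hℓ hVQ hπ hCh M.H [] M.s₀ (by simp)
    (roundUp (unit M ε) B) (by simp [budgetsAt]) rfl hV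
  refine ⟨π, hπ, ?_, fun i => ?_⟩
  · rw [EReal.coe_zero, sub_zero, Policy.value_eq_valueFrom, ← h1, optValue]
    exact iSup₂_le fun π' hπ' => value_le_outputValue hC hℓ B π' hπ'
  · have h3 := h2 i
    have h4 := toVec_roundUp_le hℓ B i
    rw [h0]
    linarith

end Correctness

/-! ### The running time -/

section Reachable

variable (M : CaMDP m) (f : Vec m → Vec m → Vec m) (g : ℝ → Vec m) (ℓ : ℝ)
  (h : Fin M.H) (s : Fin M.S) (a : Fin M.A)

/-- The layers in the table have no repetitions and consist of rounded partial costs. -/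
def IsReachableTable (Bhat : List (Key m)) (layers : Table ℕ (List (Key m))) : Prop :=
  ∀ k, (layer layers k).Nodup ∧ ∀ F ∈ layer layers k, ∃ β : Fin M.S → Key m,
    (∀ t, β t ∈ Bhat) ∧ F = roundedPrefix f g ℓ (M.P h s a) β k

variable {M f g ℓ h s a}

theorem roundedPrefix_update (β : Fin M.S → Key m) (t : Fin M.S) (b : Key m) (k : ℕ)
    (hk : k ≤ t.1) : roundedPrefix f g ℓ (M.P h s a) (Function.update β t b) k =
      roundedPrefix f g ℓ (M.P h s a) β k := by
  induction k with
  | zero => rfl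
  | succ k ih =>
    have hkS : k < M.S := by have := t.2; omega
    have hne : (⟨k, hkS⟩ : Fin M.S) ≠ t := by
      rintro rfl
      simp at hk
    rw [roundedPrefix, roundedPrefix, dif_pos hkS, dif_pos hkS, ih (by omega),
      Function.update_of_ne hne]

/-- The body of the main loop of `forwardSets`. -/
noncomputable def forwardStep (M : CaMDP m) (f : Vec m → Vec m → Vec m) (g : ℝ → Vec m) (ℓ : ℝ)
    (h : Fin M.H) (s : Fin M.S) (a : Fin M.A) (Bhat : List (Key m)) (t : Fin M.S)
    (layers : Table ℕ (List (Key m))) : Timed (Table ℕ (List (Key m))) := do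
  let L ← Table.read 1 layers t.1
  let res ← Timed.loop (L.getD []) (fun F => Timed.loop Bhat (collectStep M f g ℓ h s a t F))
    ([], Table.empty)
  Table.write 1 layers (t.1 + 1) res.1

theorem isReachableTable_forwardStep {Bhat : List (Key m)} (t : Fin M.S)
    {layers : Table ℕ (List (Key m))} (hl : IsReachableTable M f g ℓ h s a Bhat layers) :
    IsReachableTable M f g ℓ h s a Bhat (forwardStep M f g ℓ h s a Bhat t layers).val := by
  intro k
  obtain ⟨r1, -, r3⟩ := val_collect_loop M f g ℓ h s a t (layer layers t.1) Bhat
  simp only [forwardStep, Timed.val_bind, Table.val_read, Table.val_write]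
  by_cases hk : k = t.1 + 1
  · subst hk
    simp only [layer, Function.update_self, Option.getD_some]
    refine ⟨r1, fun F' hF' => ?_⟩
    obtain ⟨F, hF, b, hb, rfl⟩ := r3 F' hF'
    obtain ⟨β, hβ, rfl⟩ := (hl t.1).2 F hF
    refine ⟨Function.update β t b, fun t' => ?_, ?_⟩
    · by_cases ht : t' = t
      · rw [ht, Function.update_self]
        exact hb
      · rw [Function.update_of_ne ht]
        exact hβ t'
    · rw [roundedPrefix, dif_pos t.2, roundedPrefix_update β t b t.1 le_rfl,
        Function.update_self]
  · have : layer (Function.update layers (t.1 + 1) (some (Timed.loop ((layers t.1).getD [])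
        (fun F => Timed.loop Bhat (collectStep M f g ℓ h s a t F)) ([], Table.empty)).val.1)) k =
        layer layers k := by
      simp [layer, hk]
    rw [this]
    exact hl k

theorem isReachableTable_init {Bhat : List (Key m)} (hB : Bhat ≠ []) :
    IsReachableTable M f g ℓ h s a Bhat (Table.write 1 Table.empty 0 [(0 : Key m)]).val := by
  obtain ⟨b, hb⟩ := List.exists_mem_of_ne_nil _ hB
  intro k
  cases k with
  | zero =>
    simp only [layer, Table.val_write, Function.update_self, Option.getD_some]
    refine ⟨List.nodup_singleton _, fun F hF => ⟨fun _ => b, fun _ => hb, ?_⟩⟩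
    exact List.mem_singleton.1 hF
  | succ k => simp [layer, Table.empty]

theorem isReachableTable_forwardSets {Bhat : List (Key m)} (hB : Bhat ≠ []) :
    IsReachableTable M f g ℓ h s a Bhat (forwardSets M f g ℓ h s a Bhat).val :=
  Timed.loop_invariant_const (List.finRange M.S) (forwardStep M f g ℓ h s a Bhat) _
    (IsReachableTable M f g ℓ h s a Bhat) (isReachableTable_init hB)
    fun t _ _ hst => isReachableTable_forwardStep t hst

end Reachable

/-- A bound for the coordinates of the rounded budgets and of the rounded partial costs. -/
noncomputable def coordBound (M : CaMDP m) (ℓ : ℝ) : ℕ :=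
  ⌈M.H * ‖M.cMax - M.cMin‖ / ℓ + 1 + M.S⌉₊

/-- A bound for the number of rounded budgets and for the number of rounded partial costs. -/
noncomputable def keyBound (M : CaMDP m) (ℓ : ℝ) : ℕ := (2 * coordBound M ℓ + 1) ^ m

theorem one_le_keyBound (M : CaMDP m) (ℓ : ℝ) : 1 ≤ keyBound M ℓ := Nat.one_le_pow _ _ (by omega)

theorem length_le_of_bounded {L : List (Key m)} (hL : L.Nodup) {Z : ℕ}
    (hZ : ∀ F ∈ L, ∀ i, |F i| ≤ Z) : L.length ≤ (2 * Z + 1) ^ m := by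
  have h1 : L ⊆ box m (-Z) Z := fun F hF => mem_box.2 fun i => abs_le.1 (hZ F hF i)
  have h2 := (hL.subperm h1).length_le
  rw [length_box] at h2
  convert h2 using 2
  omega

theorem abs_le_coordBound (M : CaMDP m) {ℓ : ℝ} (hℓ : 0 < ℓ) {x : ℤ}
    (hx : |(x : ℝ) * ℓ| ≤ M.H * ‖M.cMax - M.cMin‖ + ℓ + M.S * ℓ) : |x| ≤ coordBound M ℓ := by
  have h1 : |(x : ℝ)| ≤ M.H * ‖M.cMax - M.cMin‖ / ℓ + 1 + M.S := by
    rw [abs_mul, abs_of_pos hℓ, ← le_div_iff₀ hℓ] at hx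
    refine hx.trans_eq ?_
    field_simp
  have h2 : |(x : ℝ)| ≤ coordBound M ℓ := h1.trans (Nat.le_ceil _)
  exact_mod_cast h2

theorem abs_toVec_le_of_mem_budgetGrid (M : CaMDP m) {ℓ : ℝ} (hℓ : 0 < ℓ) {b : Key m}
    (hb : b ∈ (budgetGrid M ℓ).val) (i : Fin m) :
    |toVec ℓ b i| ≤ M.H * ‖M.cMax - M.cMin‖ + ℓ := by
  obtain ⟨⟨h1, h2⟩, -⟩ := costRange_spec M
  rw [val_budgetGrid, mem_box] at hb
  have hlo : M.H * (costRange M).val.1 / ℓ ≤ b i :=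
    (Int.le_ceil _).trans (by exact_mod_cast (hb i).1)
  have hhi : (b i : ℝ) ≤ M.H * (costRange M).val.2 / ℓ + 1 :=
    le_trans (by exact_mod_cast (hb i).2) (Int.ceil_lt_add_one _).le
  rw [div_le_iff₀ hℓ] at hlo
  have hhi' : (b i : ℝ) * ℓ ≤ M.H * (costRange M).val.2 + ℓ := by
    calc (b i : ℝ) * ℓ ≤ (M.H * (costRange M).val.2 / ℓ + 1) * ℓ := by gcongr
      _ = _ := by field_simp
  have h3 : -(M.H * ‖M.cMax - M.cMin‖) ≤ M.H * (costRange M).val.1 := by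
    rw [← mul_neg]
    exact mul_le_mul_of_nonneg_left h1.1 (Nat.cast_nonneg _)
  have h4 : M.H * (costRange M).val.2 ≤ M.H * ‖M.cMax - M.cMin‖ :=
    mul_le_mul_of_nonneg_left h2.2 (Nat.cast_nonneg _)
  rw [toVec, abs_le]
  constructor <;> linarith

theorem length_budgetGrid_le (M : CaMDP m) {ℓ : ℝ} (hℓ : 0 < ℓ) :
    (budgetGrid M ℓ).val.length ≤ keyBound M ℓ := by
  refine length_le_of_bounded (Finset.nodup_toList _) fun b hb i => abs_le_coordBound M hℓ ?_
  have h1 := abs_toVec_le_of_mem_budgetGrid M hℓ hb i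
  rw [toVec] at h1
  have : 0 ≤ M.S * ℓ := by positivity
  linarith

/-- Rounded partial costs are bounded like single budgets, up to rounding errors, although the
weights need not sum to `1`. -/
theorem length_layer_le {M : CaMDP m} {f : Vec m → Vec m → Vec m} {g : ℝ → Vec m} {ℓ : ℝ}
    (hfg : IsShortPair f g) (hℓ : 0 < ℓ) {h : Fin M.H} {s : Fin M.S} {a : Fin M.A}
    (ha : a ∈ M.act h s) {layers : Table ℕ (List (Key m))}
    (hl : IsReachableTable M f g ℓ h s a (budgetGrid M ℓ).val layers) (k : ℕ) (hk : k ≤ M.S) :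
    (layer layers k).length ≤ keyBound M ℓ := by
  obtain ⟨h1, h2⟩ := hl k
  refine length_le_of_bounded h1 fun F hF i => abs_le_coordBound M hℓ ?_
  obtain ⟨β, hβ, rfl⟩ := h2 F hF
  obtain ⟨h3, h4⟩ := hfg.roundedPrefix_bounds hℓ (M.P h s a) β k hk
  have h5 := hfg.abs_prefixComb_le (M.P_mem h s a ha) (x := fun j => toVec ℓ (β j))
    (δ := M.H * ‖M.cMax - M.cMin‖ + ℓ) (by positivity)
    (fun j i => abs_toVec_le_of_mem_budgetGrid M hℓ (hβ j) i) k hk i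
  have h6 := h3 i
  have h7 := h4 i
  have h8 : (k : ℝ) * ℓ ≤ M.S * ℓ := by gcongr
  have h9 : 0 ≤ (k : ℝ) * ℓ := by positivity
  rw [abs_le] at h5
  change |toVec ℓ (roundedPrefix f g ℓ (M.P h s a) β k) i| ≤ _
  rw [abs_le]
  constructor <;> linarith

section Steps

variable {M : CaMDP m} {f : Vec m → Vec m → Vec m} {g : ℝ → Vec m} {ℓ : ℝ}
  {h : Fin M.H} {s : Fin M.S} {a : Fin M.A}

theorem steps_nextPartial (t : Fin M.S) (F b : Key m) :
    (nextPartial M f g ℓ h s a t F b).steps = 7 * m + 1 := by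
  simp only [nextPartial, Timed.steps_bind, Timed.steps_op, Timed.steps_vec]
  ring

theorem steps_collectStep_le (t : Fin M.S) (F b : Key m)
    (st : List (Key m) × Table (Key m) Unit) :
    (collectStep M f g ℓ h s a t F b st).steps ≤ 9 * m + 4 := by
  simp only [collectStep, Timed.steps_bind, steps_nextPartial, Table.steps_read, Table.val_read]
  generalize st.2 (nextPartial M f g ℓ h s a t F b).val = o
  cases o with
  | some u =>
    simp only [Timed.steps_pure]
    omega
  | none =>
    simp only [Timed.steps_bind, Table.steps_write, Timed.steps_op]
    omega

theorem S_pos (s : Fin M.S) : 1 ≤ M.S := by have := s.2; omega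

theorem steps_forwardSets_le (hfg : IsShortPair f g) (hℓ : 0 < ℓ) (ha : a ∈ M.act h s) :
    (forwardSets M f g ℓ h s a (budgetGrid M ℓ).val).steps ≤
      (9 * m + 16) * (M.S * keyBound M ℓ ^ 2) := by
  set Bhat := (budgetGrid M ℓ).val with hBh
  set N := keyBound M ℓ with hN
  have hN1 : 1 ≤ N := one_le_keyBound M ℓ
  have hS1 := S_pos s
  have hB : Bhat ≠ [] := budgetGrid_ne_nil M hℓ
  have hloop := Timed.loop_steps_le_of_invariant (List.finRange M.S)
    (forwardStep M f g ℓ h s a Bhat) (Table.write 1 Table.empty 0 [(0 : Key m)]).val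
    (IsReachableTable M f g ℓ h s a Bhat) (n := M.S) (c := 2 + (N * (N * (9 * m + 6) + 2) + 2))
    (by simp) hS1 (isReachableTable_init hB) (fun t _ st hst => isReachableTable_forwardStep t hst)
    (fun t _ st hst => by
      simp only [forwardStep, Timed.steps_bind, Table.steps_read, Table.steps_write, Table.val_read]
      gcongr
      refine Timed.loop_steps_le _ _ _ (length_layer_le hfg hℓ ha hst t.1 t.2.le) hN1
        fun F _ st => ?_
      exact Timed.loop_steps_le _ _ _ (length_budgetGrid_le M hℓ) hN1
        fun b _ st => steps_collectStep_le t F b st)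
  have hsteps : (forwardSets M f g ℓ h s a Bhat).steps = 2 + (Timed.loop (List.finRange M.S)
      (forwardStep M f g ℓ h s a Bhat)
      (Table.write 1 Table.empty 0 [(0 : Key m)]).val).steps := rfl
  rw [hsteps]
  have e1 : M.S * 1 ≤ M.S * N ^ 2 := Nat.mul_le_mul_left _ (Nat.one_le_pow _ _ hN1)
  have e2 : M.S * N ≤ M.S * N ^ 2 := Nat.mul_le_mul_left _ (Nat.le_self_pow (by omega) _)
  linarith

theorem steps_approxDP_le (hfg : IsShortPair f g) (hℓ : 0 < ℓ) (ha : a ∈ M.act h s) (b : Key m)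
    (V : ValueTable M) {layers : Table ℕ (List (Key m))}
    (hl : IsReachableTable M f g ℓ h s a (budgetGrid M ℓ).val layers) :
    (approxDP M f g ℓ h s a b (budgetGrid M ℓ).val V layers).steps ≤
      (16 * m + 28) * (M.S * keyBound M ℓ ^ 2) := by
  set Bhat := (budgetGrid M ℓ).val with hBh
  set N := keyBound M ℓ with hN
  have hN1 : 1 ≤ N := one_le_keyBound M ℓ
  have hS1 := S_pos s
  simp only [approxDP, Timed.steps_bind, Timed.steps_vec, Timed.steps_op, Table.steps_read,
    Table.val_read]
  have h1 : ∀ (body : Key m → DPTable m → Timed (DPTable m)) (st : DPTable m),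
      (∀ F st, (body F st).steps ≤ 4 * m + 2) →
      (Timed.loop ((layers M.S).getD []) body st).steps ≤ N * (4 * m + 2 + 2) :=
    fun body st hb => Timed.loop_steps_le _ _ _ (length_layer_le hfg hℓ ha hl M.S le_rfl) hN1
      fun F _ st => hb F st
  have h2 : ∀ (body : Fin M.S → DPTable m → Timed (DPTable m)) (st : DPTable m),
      (∀ t st, (body t st).steps ≤ 2 + N * (N * (9 * m + 10 + 2) + (m + 2) + 2)) →
      (Timed.loop (List.finRange M.S).reverse body st).steps ≤
        M.S * (2 + N * (N * (9 * m + 10 + 2) + (m + 2) + 2) + 2) :=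
    fun body st hb => Timed.loop_steps_le _ _ _ (by simp) hS1 fun t _ st => hb t st
  refine (add_le_add le_rfl (add_le_add le_rfl (add_le_add le_rfl (add_le_add le_rfl
    (add_le_add le_rfl (add_le_add (h1 _ _ ?_) (h2 _ _ ?_))))))).trans ?_
  · intro F st
    simp only [Timed.steps_bind, Timed.steps_vec, Timed.steps_charge, Table.steps_write]
    omega
  · intro t st
    simp only [Timed.steps_bind, Table.steps_read]
    gcongr
    refine Timed.loop_steps_le _ _ _ (length_layer_le hfg hℓ ha hl t.1 t.2.le) hN1 fun F _ st => ?_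
    simp only [Timed.steps_bind, Table.steps_write]
    refine add_le_add (Timed.loop_steps_le _ _ _ (length_budgetGrid_le M hℓ) hN1
      fun b' _ best => ?_) le_rfl
    simp only [Timed.steps_bind, Table.steps_read, Timed.steps_op, steps_nextPartial,
      steps_keepBetter]
    omega
  · have e1 : M.S * 1 ≤ M.S * N ^ 2 := Nat.mul_le_mul_left _ (Nat.one_le_pow _ _ hN1)
    have e2 : M.S * N ≤ M.S * N ^ 2 := Nat.mul_le_mul_left _ (Nat.le_self_pow (by omega) _)
    have e3 : 1 * N ≤ M.S * N := Nat.mul_le_mul_right _ hS1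
    have e4 : m * 1 ≤ m * (M.S * N ^ 2) := Nat.mul_le_mul_left _ (by omega)
    have e5 : m * (M.S * N) ≤ m * (M.S * N ^ 2) := Nat.mul_le_mul_left _ e2
    have e6 : m * (1 * N) ≤ m * (M.S * N) := Nat.mul_le_mul_left _ e3
    linarith

theorem steps_recoverBudgets_le (T : DPTable m) :
    (recoverBudgets M f g ℓ h s a T).steps ≤ M.S * (8 * m + 7) := by
  simp only [recoverBudgets, Timed.steps_bind, Timed.steps_pure, add_zero]
  refine Timed.loop_steps_le (c := 8 * m + 5) _ _ _ (by simp) (S_pos s) fun t _ st => ?_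
  simp only [Timed.steps_bind, Table.steps_read, Table.steps_write, steps_nextPartial,
    Timed.steps_pure]
  omega

theorem A_pos (h : Fin M.H) (s : Fin M.S) : 1 ≤ M.A := by
  obtain ⟨a, -⟩ := M.act_nonempty h s
  have := a.2
  omega

theorem steps_updateStep_le (hfg : IsShortPair f g) (hℓ : 0 < ℓ) (b : Key m)
    (st : ValueTable M × AugPolicy M) :
    (updateStep M f g ℓ (budgetGrid M ℓ).val h s b st).steps ≤
      (36 * m + 65) * (M.A * (M.S * keyBound M ℓ ^ 2)) := by
  set Bhat := (budgetGrid M ℓ).val with hBh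
  set N := keyBound M ℓ with hN
  set X := M.S * N ^ 2 with hX
  have hN1 : 1 ≤ N := one_le_keyBound M ℓ
  have hS1 := S_pos s
  have hA1 := A_pos h s
  have hX1 : M.S * 1 ≤ X := Nat.mul_le_mul_left _ (Nat.one_le_pow _ _ hN1)
  have hB : Bhat ≠ [] := budgetGrid_ne_nil M hℓ
  have h1 : (approxUpdate M f g ℓ h s b Bhat st.1).steps ≤
      M.A * (1 + ((9 * m + 16) * X + ((16 * m + 28) * X + ((m + 2) + (1 + 1)))) + 2) +
        M.S * (8 * m + 7) := by
    simp only [approxUpdate, Timed.steps_bind]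
    refine add_le_add (Timed.loop_steps_le _ _ _ (by simp) hA1 fun a _ best => ?_) ?_
    · simp only [Timed.steps_bind, Timed.steps_op, Timed.val_op]
      by_cases ha : a ∈ M.act h s
      · simp only [ha, decide_true, if_true, Timed.steps_bind, Table.steps_read, Timed.steps_op,
          steps_keepBetter]
        refine add_le_add le_rfl (add_le_add (steps_forwardSets_le hfg hℓ ha)
          (add_le_add (steps_approxDP_le hfg hℓ ha b st.1 (isReachableTable_forwardSets hB)) ?_))
        omega
      · simp [ha]
    · split
      · simp
      · simp only [Timed.steps_bind, Timed.steps_pure, add_zero]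
        exact steps_recoverBudgets_le _
  have h2 : (updateStep M f g ℓ Bhat h s b st).steps ≤
      (approxUpdate M f g ℓ h s b Bhat st.1).steps + (2 * m + 6) := by
    simp only [updateStep, Timed.steps_bind]
    split
    · simp
    · simp only [Timed.steps_bind, Table.steps_write, Timed.steps_pure]
      omega
  have e1 : M.A * 1 ≤ M.A * X := Nat.mul_le_mul_left _ (by omega)
  have e2 : 1 * X ≤ M.A * X := Nat.mul_le_mul_right _ hA1
  have e3 : m * 1 ≤ m * (M.A * X) := Nat.mul_le_mul_left _ (by omega)
  have e4 : m * (M.A * 1) ≤ m * (M.A * X) := Nat.mul_le_mul_left _ e1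
  have e5 : m * (1 * X) ≤ m * (M.A * X) := Nat.mul_le_mul_left _ e2
  have e6 : m * (M.S * 1) ≤ m * X := Nat.mul_le_mul_left _ hX1
  linarith

theorem steps_approxBackwardInduction_le (hfg : IsShortPair f g) (hℓ : 0 < ℓ) (b₀ : Key m) :
    (approxBackwardInduction M f g ℓ (budgetGrid M ℓ).val b₀).steps ≤
      (74 * m + 150) * (M.H * M.S ^ 2 * M.A * keyBound M ℓ ^ 3) := by
  set Bhat := (budgetGrid M ℓ).val with hBh
  set N := keyBound M ℓ with hN
  have hN1 : 1 ≤ N := one_le_keyBound M ℓ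
  have hS1 := S_pos M.s₀
  have hH1 : 1 ≤ M.H := M.H_pos
  have hA1 := A_pos ⟨0, M.H_pos⟩ M.s₀
  have hBN : Bhat.length ≤ N := length_budgetGrid_le M hℓ
  set c := (36 * m + 65) * (M.A * (M.S * N ^ 2)) with hc
  have h1 : (approxBackwardInduction M f g ℓ Bhat b₀).steps ≤
      M.S * (N * (m + (m + 3) + 2) + 2) +
        M.H * (1 + M.S * (2 * N * (c + 2) + 2) + 2) := by
    simp only [approxBackwardInduction, Timed.steps_bind]
    refine add_le_add (Timed.loop_steps_le _ _ _ (by simp) hS1 fun s _ V =>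
      Timed.loop_steps_le _ _ _ hBN hN1 fun b _ V => ?_)
      (Timed.loop_steps_le _ _ _ (by simp) hH1 fun h _ st => ?_)
    · simp only [Timed.steps_bind, Timed.steps_charge, Table.steps_write]
      omega
    · simp only [Timed.steps_bind, Timed.steps_op, Timed.val_op]
      refine add_le_add le_rfl (Timed.loop_steps_le _ _ _ (by simp) hS1 fun s _ st =>
        Timed.loop_steps_le _ _ _ ?_ (by omega) fun b _ st => ?_)
      · split_ifs
        · rw [List.length_cons]
          omega
        · omega
      · exact steps_updateStep_le hfg hℓ b st
  set Y := M.H * M.S ^ 2 * M.A * N ^ 3 with hY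
  have hpow : ∀ i j, i ≤ j → N ^ i ≤ N ^ j := fun i j => Nat.pow_le_pow_right hN1
  have hmain : M.H * (M.S * (2 * N * c)) = (72 * m + 130) * Y := by
    rw [hc, hY]
    ring
  have e1 : M.H * M.S * N ≤ Y := by
    calc M.H * M.S * N = M.H * M.S ^ 1 * 1 * N ^ 1 := by ring
      _ ≤ Y := by
        rw [hY]
        gcongr
        · omega
        · omega
  have e2 : M.H * M.S * 1 ≤ M.H * M.S * N := Nat.mul_le_mul_left _ hN1
  have e3 : M.H * 1 ≤ M.H * M.S := Nat.mul_le_mul_left _ hS1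
  have e4 : 1 * (M.S * N) ≤ M.H * (M.S * N) := Nat.mul_le_mul_right _ hH1
  have e5 : M.S * 1 ≤ M.S * N := Nat.mul_le_mul_left _ hN1
  have e6 : m * (1 * (M.S * N)) ≤ m * (M.H * (M.S * N)) := Nat.mul_le_mul_left _ e4
  have e7 : m * (M.H * M.S * N) ≤ m * Y := Nat.mul_le_mul_left _ e1
  linarith

theorem steps_costRange_le (M : CaMDP m) :
    (costRange M).steps ≤ (5 * m + 12) * (M.H * M.S * M.A) := by
  have hS1 := S_pos M.s₀
  have hH1 : 1 ≤ M.H := M.H_pos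
  have hA1 := A_pos ⟨0, M.H_pos⟩ M.s₀
  have h1 : (costRange M).steps ≤
      M.H * (M.S * (M.A * (1 + (m + 1) * (3 + 2) + 2) + 2) + 2) := by
    refine Timed.loop_steps_le _ _ _ (by simp) hH1 fun h _ st =>
      Timed.loop_steps_le _ _ _ (by simp) hS1 fun s _ st =>
      Timed.loop_steps_le _ _ _ (by simp) hA1 fun a _ st => ?_
    simp only [Timed.steps_bind, Timed.steps_op, Timed.val_op]
    refine add_le_add le_rfl ?_
    by_cases ha : a ∈ M.act h s
    · simp only [ha, decide_true, if_true]
      refine Timed.loop_steps_le _ _ _ (by simp) (by omega) fun i _ st => ?_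
      simp only [Timed.steps_bind, Timed.steps_op, Timed.steps_pure]
      omega
    · simp [ha]
  have e1 : M.H * M.S * 1 ≤ M.H * M.S * M.A := Nat.mul_le_mul_left _ hA1
  have e2 : M.H * 1 ≤ M.H * M.S := Nat.mul_le_mul_left _ hS1
  linarith

/-- The number of steps in terms of the number of rounded budgets. -/
theorem steps_bicriteria_le (hfg : IsShortPair f g) (hℓ : 0 < ℓ) (B : Vec m) :
    (bicriteria M f g B ℓ).steps ≤
      (84 * m + 174) * (M.H * M.S ^ 2 * M.A * keyBound M ℓ ^ 3) := by
  set N := keyBound M ℓ with hN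
  have hN1 : 1 ≤ N := one_le_keyBound M ℓ
  have hS1 := S_pos M.s₀
  have hH1 : 1 ≤ M.H := M.H_pos
  have hA1 := A_pos ⟨0, M.H_pos⟩ M.s₀
  have hBN : (budgetGrid M ℓ).val.length ≤ N := length_budgetGrid_le M hℓ
  have h1 : (bicriteria M f g B ℓ).steps = (costRange M).steps +
      (6 + (m + 1) * ((budgetGrid M ℓ).val.length + 1)) + (2 * m +
      ((approxBackwardInduction M f g ℓ (budgetGrid M ℓ).val (roundUp ℓ B)).steps +
        (m + 4))) := by
    simp only [bicriteria, Timed.steps_bind, Timed.steps_charge, Timed.val_charge,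
      Table.steps_read, Timed.steps_op, Timed.steps_pure]
    rw [val_budgetGrid]
    simp only [budgetGrid, Timed.steps_bind, Timed.steps_charge, Timed.val_op, Timed.steps_op]
    ring
  have h2 := steps_costRange_le M
  have h3 := steps_approxBackwardInduction_le (M := M) hfg hℓ (roundUp ℓ B)
  have h4 : (m + 1) * ((budgetGrid M ℓ).val.length + 1) ≤ (m + 1) * (N + 1) :=
    Nat.mul_le_mul_left _ (by omega)
  rw [h1]
  set Y := M.H * M.S ^ 2 * M.A * N ^ 3 with hY
  have e1 : M.H * M.S * M.A ≤ Y := by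
    calc M.H * M.S * M.A = M.H * M.S ^ 1 * M.A * 1 := by ring
      _ ≤ Y := by
        rw [hY]
        gcongr
        · omega
        · exact Nat.one_le_pow _ _ hN1
  have e2 : N ≤ Y := by
    calc N = 1 * 1 ^ 2 * 1 * N ^ 1 := by ring
      _ ≤ Y := by
        rw [hY]
        gcongr
        omega
  have e3 : m * (M.H * M.S * M.A) ≤ m * Y := Nat.mul_le_mul_left _ e1
  have e4 : m * N ≤ m * Y := Nat.mul_le_mul_left _ e2
  have e5 : m * 1 ≤ m * Y := Nat.mul_le_mul_left _ (by omega)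
  linarith

end Steps

/-! ### The explicit bound -/

theorem keyBound_unit_le (M : CaMDP m) {ε : ℝ} (hε : 0 < ε) :
    (keyBound M (unit M ε) : ℝ) ≤
      (13 * ((M.H : ℝ) ^ 2 * M.S * max 1 (‖M.cMax - M.cMin‖ / ε))) ^ m := by
  set X := max 1 (‖M.cMax - M.cMin‖ / ε) with hX
  have hX1 : 1 ≤ X := le_max_left _ _
  have hXD : ‖M.cMax - M.cMin‖ / ε ≤ X := le_max_right _ _
  have hS : (1 : ℝ) ≤ M.S := by exact_mod_cast S_pos M.s₀
  have hH : (1 : ℝ) ≤ M.H := by exact_mod_cast M.H_pos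
  have hHH : (M.H : ℝ) ≤ (M.H : ℝ) ^ 2 := by nlinarith
  have hSH : (M.S : ℝ) ≤ (M.H : ℝ) ^ 2 * M.S := by nlinarith
  have hSHX : (M.H : ℝ) ^ 2 * M.S ≤ (M.H : ℝ) ^ 2 * M.S * X :=
    le_mul_of_one_le_right (by positivity) hX1
  rw [keyBound]
  push_cast
  refine pow_le_pow_left₀ (by positivity) ?_ m
  have h1 : (coordBound M (unit M ε) : ℝ) ≤
      M.H * ‖M.cMax - M.cMin‖ / unit M ε + 1 + M.S + 1 := by
    refine (Nat.ceil_lt_add_one ?_).le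
    have : 0 < unit M ε := by
      rw [unit]
      positivity
    positivity
  have h2 : M.H * ‖M.cMax - M.cMin‖ / unit M ε =
      (M.H * (1 + ((M.S : ℝ) + 1) * M.H)) * (‖M.cMax - M.cMin‖ / ε) := by
    rw [unit]
    field_simp
  -- `1 + (S + 1) H ≤ 3 S H`
  have h3 : (M.H : ℝ) * (1 + ((M.S : ℝ) + 1) * M.H) ≤ 3 * ((M.H : ℝ) ^ 2 * M.S) := by
    nlinarith [mul_nonneg (sub_nonneg.2 hH) (sub_nonneg.2 hS)]
  have h4 : (M.H * (1 + ((M.S : ℝ) + 1) * M.H)) * (‖M.cMax - M.cMin‖ / ε) ≤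
      3 * ((M.H : ℝ) ^ 2 * M.S) * X :=
    mul_le_mul h3 hXD (by positivity) (by positivity)
  rw [h2] at h1
  linarith

theorem steps_bicriteria_unit_le {f : Vec m → Vec m → Vec m} {g : ℝ → Vec m}
    (hfg : IsShortPair f g) (M : CaMDP m) (B : Vec m) {ε : ℝ} (hε : 0 < ε) :
    ((bicriteria M f g B (unit M ε)).steps : ℝ) ≤
      ((84 * m + 174) * 13 ^ (3 * m)) * ((M.H : ℝ) ^ (6 * m + 1) * (M.S : ℝ) ^ (4 * m + 2) *
        (M.A : ℝ) * (max 1 (‖M.cMax - M.cMin‖ / ε)) ^ (3 * m)) := by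
  have hℓ : 0 < unit M ε := by
    rw [unit]
    positivity
  have h1 : ((bicriteria M f g B (unit M ε)).steps : ℝ) ≤
      (84 * m + 174) * (M.H * (M.S : ℝ) ^ 2 * M.A * (keyBound M (unit M ε) : ℝ) ^ 3) := by
    exact_mod_cast steps_bicriteria_le (M := M) hfg hℓ B
  have h2 := keyBound_unit_le M hε
  set X := max 1 (‖M.cMax - M.cMin‖ / ε) with hX
  have hX1 : 1 ≤ X := le_max_left _ _
  have hS : (1 : ℝ) ≤ M.S := by exact_mod_cast S_pos M.s₀
  calc ((bicriteria M f g B (unit M ε)).steps : ℝ)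
      ≤ (84 * m + 174) * (M.H * (M.S : ℝ) ^ 2 * M.A * (keyBound M (unit M ε) : ℝ) ^ 3) := h1
    _ ≤ (84 * m + 174) * (M.H * (M.S : ℝ) ^ 2 * M.A *
          ((13 * ((M.H : ℝ) ^ 2 * M.S * X)) ^ m) ^ 3) := by gcongr
    _ = ((84 * m + 174) * 13 ^ (3 * m)) * ((M.H : ℝ) ^ (6 * m + 1) * (M.S : ℝ) ^ (3 * m + 2) *
          (M.A : ℝ) * X ^ (3 * m)) := by
        rw [← pow_mul, mul_comm m 3, mul_pow, mul_pow, mul_pow, ← pow_mul,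
          show 2 * (3 * m) = 6 * m by ring]
        ring
    _ ≤ ((84 * m + 174) * 13 ^ (3 * m)) * ((M.H : ℝ) ^ (6 * m + 1) * (M.S : ℝ) ^ (4 * m + 2) *
          (M.A : ℝ) * X ^ (3 * m)) := by
        gcongr
        omega

/-- The polynomial whose coefficients are the absolute values of those of `p`. -/
noncomputable def absPolynomial (p : Polynomial ℝ) : Polynomial ℝ :=
  ∑ i ∈ Finset.range (p.natDegree + 1), Polynomial.C |p.coeff i| * Polynomial.X ^ i

theorem eval_absPolynomial (p : Polynomial ℝ) (y : ℝ) :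
    (absPolynomial p).eval y = ∑ i ∈ Finset.range (p.natDegree + 1), |p.coeff i| * y ^ i := by
  simp [absPolynomial, Polynomial.eval_finsetSum]

theorem eval_le_eval_absPolynomial (p : Polynomial ℝ) {x y : ℝ} (hx : 0 ≤ x) (hxy : x ≤ y) :
    p.eval x ≤ (absPolynomial p).eval y := by
  rw [eval_absPolynomial, Polynomial.eval_eq_sum_range]
  refine Finset.sum_le_sum fun i _ => ?_
  exact mul_le_mul (le_abs_self _) (pow_le_pow_left₀ hx hxy i) (by positivity) (abs_nonneg _)

theorem max_div_le {D ε P y : ℝ} (hε : 0 < ε) (hD : 0 ≤ D) (hDP : D ≤ P) (hy : 1 / ε ≤ y) :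
    max 1 (D / ε) ≤ 1 + P * y := by
  have h0 : 0 < 1 / ε := by positivity
  have h1 : D / ε ≤ P * y := by
    rw [div_eq_mul_one_div]
    exact mul_le_mul hDP hy h0.le (hD.trans hDP)
  have h2 : 0 ≤ D / ε := by positivity
  exact max_le (by linarith) (by linarith)

theorem le_tableSize (M : CaMDP m) :
    M.H ≤ M.tableSize ∧ M.S ≤ M.tableSize ∧ M.A ≤ M.tableSize := by
  have hS := S_pos M.s₀
  have hH : 1 ≤ M.H := M.H_pos
  have hA := A_pos ⟨0, M.H_pos⟩ M.s₀
  rw [CaMDP.tableSize]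
  refine ⟨?_, ?_, Nat.le_mul_of_pos_left _ (Nat.mul_pos hH hS)⟩
  · rw [mul_assoc]
    exact Nat.le_mul_of_pos_right _ (Nat.mul_pos hS hA)
  · exact (Nat.le_mul_of_pos_left _ hH).trans (Nat.le_mul_of_pos_right _ hA)

end CMDP

theorem theorem3 (m : ℕ) :
    -- the algorithm is a `(0, ε)`-bicriteria
    (∀ (C : CMDP.CostCriterion m) (f : CMDP.Vec m → CMDP.Vec m → CMDP.Vec m) (g : ℝ → CMDP.Vec m),
      CMDP.IsSR C f g → ∀ (M : CMDP.CaMDP m) (B : CMDP.Vec m) (ε : ℝ), 0 < ε →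
        ((CMDP.bicriteria M f g B (CMDP.unit M ε)).val = none → ¬ CMDP.Feasible C M B) ∧
        ∀ Q : CMDP.AugPolicy M, (CMDP.bicriteria M f g B (CMDP.unit M ε)).val = some Q →
          ∃ π : CMDP.Policy M,
            CMDP.Deploys Q (CMDP.roundUp (CMDP.unit M ε) B) π ∧
            CMDP.IsBicriteriaApprox 0 ε C M B π) ∧
    -- the explicit bound on its running time
    (∃ K : ℝ, ∀ (C : CMDP.CostCriterion m) (f : CMDP.Vec m → CMDP.Vec m → CMDP.Vec m)
      (g : ℝ → CMDP.Vec m), CMDP.IsSR C f g →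
      ∀ (M : CMDP.CaMDP m) (B : CMDP.Vec m) (ε : ℝ), 0 < ε →
        ((CMDP.bicriteria M f g B (CMDP.unit M ε)).steps : ℝ) ≤
          K * ((M.H : ℝ) ^ (6 * m + 1) * (M.S : ℝ) ^ (4 * m + 2) * (M.A : ℝ) *
            (max 1 (‖M.cMax - M.cMin‖ / ε)) ^ (3 * m))) ∧
    -- for polynomially bounded costs, it is polynomial in the description size and in `1 / ε`
    (∀ p : Polynomial ℝ, ∃ q : Polynomial ℝ,
      ∀ (C : CMDP.CostCriterion m) (f : CMDP.Vec m → CMDP.Vec m → CMDP.Vec m)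
        (g : ℝ → CMDP.Vec m), CMDP.IsSR C f g →
      ∀ (M : CMDP.CaMDP m) (B : CMDP.Vec m) (ε : ℝ), 0 < ε →
      ∀ size : ℕ, M.tableSize ≤ size → ‖M.cMax - M.cMin‖ ≤ p.eval (size : ℝ) →
        ((CMDP.bicriteria M f g B (CMDP.unit M ε)).steps : ℝ) ≤ q.eval ((size : ℝ) + 1 / ε)) := by
  refine ⟨?_, ⟨_, fun C f g hC M B ε hε => CMDP.steps_bicriteria_unit_le hC.1 M B hε⟩, ?_⟩
  · intro C f g hC M B ε hε
    have hℓ : 0 < CMDP.unit M ε := by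
      rw [CMDP.unit]
      positivity
    rw [CMDP.val_bicriteria]
    by_cases hV : CMDP.outputValue M f g B (CMDP.unit M ε) = ⊥
    · rw [if_pos hV]
      refine ⟨?_, by simp⟩
      rintro - ⟨π, hπ⟩
      have h1 := CMDP.value_le_outputValue hC hℓ B π hπ
      rw [hV, le_bot_iff] at h1
      exact EReal.coe_ne_bot _ h1
    · rw [if_neg hV]
      refine ⟨by simp, fun Q hQ => ?_⟩
      rw [← Option.some_injective _ hQ]
      exact CMDP.deployed_approx hC hε B hV
  · intro p
    refine ⟨Polynomial.C ((84 * (m : ℝ) + 174) * 13 ^ (3 * m)) * (Polynomial.X ^ (6 * m + 1) *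
      Polynomial.X ^ (4 * m + 2) * Polynomial.X *
      (1 + CMDP.absPolynomial p * Polynomial.X) ^ (3 * m)), ?_⟩
    intro C f g hC M B ε hε size hsize hp
    refine (CMDP.steps_bicriteria_unit_le hC.1 M B hε).trans ?_
    obtain ⟨h1, h2, h3⟩ := CMDP.le_tableSize M
    have hε' : 0 < 1 / ε := by positivity
    have hle : ∀ n : ℕ, n ≤ M.tableSize → (n : ℝ) ≤ (size : ℝ) + 1 / ε := by
      intro n hn
      have : (n : ℝ) ≤ size := by exact_mod_cast hn.trans hsize
      linarith
    have hy : (size : ℝ) ≤ (size : ℝ) + 1 / ε := by linarith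
    have hX := CMDP.max_div_le (y := (size : ℝ) + 1 / ε) hε (norm_nonneg (M.cMax - M.cMin))
      (hp.trans (CMDP.eval_le_eval_absPolynomial p (Nat.cast_nonneg _) hy))
      (by have : (0 : ℝ) ≤ size := Nat.cast_nonneg _; linarith)
    simp only [Polynomial.eval_mul, Polynomial.eval_C, Polynomial.eval_pow, Polynomial.eval_X,
      Polynomial.eval_add, Polynomial.eval_one]
    gcongr
    · exact hle _ h1
    · exact hle _ h2
    · exact hle _ h3
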